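/- Conventions. Algebras are nonempty and finitary; a variety is the class of all algebras of a given similarity type that satisfy a given set of identities. For an algebra $A$, $\operatorname{Con}_c A$ is the $(\vee,0)$-semilattice of compact (i.e. finitely generated) congruences of $A$, and for a homomorphism $f\colon A\to B$, $\operatorname{Con}_c f\colon \operatorname{Con}_c A\to\operatorname{Con}_c B$ sends $\alpha$ to the congruence of $B$ generated by $\{(f(x),f(y)) : (x,y)\in\alpha\}$. Let $\mathcal S$ be the category of all $(\vee,0)$-semilattices with $(\vee,0)$-homomorphisms. A lifting of a functor $\mathcal D\colon J\to\mathcal S$ in a variety $\mathcal V$ is a functor $\mathcal A\colon J\to\mathcal V$ such that $\operatorname{Con}_c\circ\mathcal A$ is naturally isomorphic to $\mathcal D$. A variety is locally $\le\mu$ if every finitely generated subalgebra of each of its members has at most $\mu$ elements. A well-founded tree is a poset with a least element in which every set $\downarrow i=\{k : k\le i\}$ is a well-founded chain. A poset is regarded as a category in the usual way. Corollary. Let $\mathcal L_1,\mathcal L_2$ be similarity types, let $\mathcal V_1$ be a variety of $\mathcal L_1$-algebras and $\mathcal V_2$ a variety of $\mathcal L_2$-algebras, let $\lambda<\kappa$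 be infinite cardinals, let $I$ be a well-founded tree, and let $J$ be a small category, such that: 1. $\mathcal V_1$ is locally $\le\kappa$ and $\mathcal V_2$ is locally $\le\lambda$; 2. $\operatorname{card}\operatorname{Mor}(J)<\kappa$; 3. $\operatorname{card} I\le\kappa$; 4. $\operatorname{card}(\downarrow i)<\operatorname{cf}\kappa$ for all $i\in I$; 5. every functor $\mathcal D\colon J\to\mathcal S$ with $\operatorname{card}\mathcal D(j)\le\kappa$ for all $j\in\operatorname{Ob}J$ that has a lifting in $\mathcal V_1$ has a lifting in $\mathcal V_2$. Let $\mathcal D\colon I\times J\to\mathcal S$ be a functor such that $\operatorname{card}\mathcal D(i,j)<\kappa$ for all $i\in I$ and $j\in\operatorname{Ob}J$, and $\sum_{j\in\operatorname{Ob}J}\operatorname{card}\mathcal D(i,j)<\kappa$ for every non-maximal $i\in I$ (the second condition follows from the first if $\kappa$ is regular, or more generally if $\operatorname{card}\operatorname{Ob}J<\operatorname{cf}\kappa$). If $\mathcal D$ has a lifting in $\mathcal V_1$, then $\mathcal D$ has a lifting in $\mathcal V_2$. -/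

import Mathlib

open CategoryTheory Cardinal

universe u v w v₁ w₁ v₂ w₂

namespace CongLift

/-- The category of algebras of a similarity type: the similarity type is a first-order language
`L` (used below only without relation symbols), an object is a nonempty `L`-structure. -/
structure AlgCat (L : FirstOrder.Language.{v, w}) : Type (max v w (u + 1)) where
  carrier : Type u
  [str : L.Structure carrier]
  [nonempty : Nonempty carrier]

namespace AlgCat

variable {L : FirstOrder.Language.{v, w}}

instance : CoeSort (AlgCat.{u} L) (Type u) := ⟨AlgCat.carrier⟩

attribute [instance] AlgCat.str AlgCat.nonempty

/-- Morphisms are the homomorphisms of algebras. -/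
instance : Category.{u} (AlgCat.{u} L) where
  Hom A B := L.Hom A B
  id A := FirstOrder.Language.Hom.id L A
  comp f g := FirstOrder.Language.Hom.comp g f

end AlgCat

/-! ### Congruences -/

/-- A congruence of an algebra: an equivalence relation compatible with all operations. -/
structure AlgCongruence (L : FirstOrder.Language.{v, w}) (A : Type u) [L.Structure A]
    extends Setoid A where
  compat : ∀ {n : ℕ} (f : L.Functions n) (x y : Fin n → A),
    (∀ k, r (x k) (y k)) →
      r (FirstOrder.Language.Structure.funMap f x) (FirstOrder.Language.Structure.funMap f y)

namespace AlgCongruence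

variable {L : FirstOrder.Language.{v, w}} {A : Type u} [L.Structure A]

theorem ext_r {θ ψ : AlgCongruence L A} (h : ∀ x y, θ.r x y ↔ ψ.r x y) : θ = ψ := by
  obtain ⟨s, hs⟩ := θ
  obtain ⟨t, ht⟩ := ψ
  obtain rfl : s = t := Setoid.ext h
  rfl

/-- Congruences are ordered by inclusion. -/
instance : PartialOrder (AlgCongruence L A) where
  le θ ψ := ∀ x y, θ.r x y → ψ.r x y
  le_refl _ _ _ h := h
  le_trans _ _ _ h₁ h₂ x y h := h₂ x y (h₁ x y h)
  le_antisymm _ _ h₁ h₂ := ext_r fun x y => ⟨h₁ x y, h₂ x y⟩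

theorem le_def {θ ψ : AlgCongruence L A} : θ ≤ ψ ↔ ∀ x y, θ.r x y → ψ.r x y := Iff.rfl

/-- Infima of congruences are intersections. -/
instance : InfSet (AlgCongruence L A) where
  sInf S :=
    { r := fun x y => ∀ θ ∈ S, θ.r x y
      iseqv :=
        ⟨fun x θ _ => θ.iseqv.refl x, fun h θ hθ => θ.iseqv.symm (h θ hθ),
          fun h₁ h₂ θ hθ => θ.iseqv.trans (h₁ θ hθ) (h₂ θ hθ)⟩
      compat := fun f x y h θ hθ => θ.compat f x y fun k => h k θ hθ }

/-- The complete lattice `Con A` of all congruences of `A`. -/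
instance : CompleteLattice (AlgCongruence L A) :=
  completeLatticeOfInf _ fun _ =>
    ⟨fun θ hθ _ _ h => h θ hθ, fun _ hψ x y h _ hθ => hψ hθ x y h⟩

/-- `gen P` is the smallest congruence of `A` containing the set of pairs `P`. -/
def gen (P : Set (A × A)) : AlgCongruence L A :=
  sInf {θ | ∀ p ∈ P, θ.r p.1 p.2}

theorem gen_le {P : Set (A × A)} {θ : AlgCongruence L A} :
    gen P ≤ θ ↔ ∀ p ∈ P, θ.r p.1 p.2 :=
  ⟨fun h p hp => h _ _ fun _ hψ => hψ p hp, fun h _ _ hxy => hxy θ h⟩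

theorem gen_of_mem {P : Set (A × A)} {p : A × A} (hp : p ∈ P) :
    (gen P : AlgCongruence L A).r p.1 p.2 :=
  gen_le.1 le_rfl p hp

/-- The union of a nonempty directed set of congruences is a congruence, hence their supremum. -/
theorem sSup_r_of_directedOn {S : Set (AlgCongruence L A)} (hne : S.Nonempty)
    (hS : DirectedOn (· ≤ ·) S) (x y : A) : (sSup S).r x y ↔ ∃ θ ∈ S, θ.r x y := by
  constructor
  · let U : AlgCongruence L A :=
      { r := fun x y => ∃ θ ∈ S, θ.r x y
        iseqv :=
          ⟨fun x => hne.imp fun θ hθ => ⟨hθ, θ.iseqv.refl x⟩,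
            fun ⟨θ, hθ, h⟩ => ⟨θ, hθ, θ.iseqv.symm h⟩,
            fun ⟨θ, hθ, h⟩ ⟨ψ, hψ, h'⟩ => by
              obtain ⟨χ, hχ, h₁, h₂⟩ := hS θ hθ ψ hψ
              exact ⟨χ, hχ, χ.iseqv.trans (h₁ _ _ h) (h₂ _ _ h')⟩⟩
        compat := fun {n} f x y h => by
          choose θ hθ hr using h
          obtain ⟨χ, hχ, hle⟩ : ∃ χ ∈ S, ∀ k ∈ (Finset.univ : Finset (Fin n)), θ k ≤ χ := by
            induction (Finset.univ : Finset (Fin n)) using Finset.induction_on with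
            | empty => exact hne.imp fun θ hθ => ⟨hθ, by simp⟩
            | insert a s _ ih =>
              obtain ⟨χ, hχ, hle⟩ := ih
              obtain ⟨χ', hχ', h₁, h₂⟩ := hS χ hχ (θ a) (hθ a)
              refine ⟨χ', hχ', fun k hk => ?_⟩
              rcases Finset.mem_insert.1 hk with rfl | hk
              · exact h₂
              · exact (hle k hk).trans h₁
          exact ⟨χ, hχ, χ.compat f x y fun k => hle k (Finset.mem_univ k) _ _ (hr k)⟩ }
    have hU : sSup S ≤ U := sSup_le fun θ hθ x y h => ⟨θ, hθ, h⟩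
    exact hU x y
  · rintro ⟨θ, hθ, h⟩
    exact le_sSup hθ x y h

/-- The compact congruences are exactly the finitely generated ones. -/
theorem isCompactElement_iff {θ : AlgCongruence L A} :
    IsCompactElement θ ↔ ∃ P : Set (A × A), P.Finite ∧ θ = gen P := by
  constructor
  · intro h
    let S : Set (AlgCongruence L A) :=
      {ψ | ∃ P : Set (A × A), P.Finite ∧ (∀ p ∈ P, θ.r p.1 p.2) ∧ ψ = gen P}
    have hle : θ ≤ sSup S := fun x y hxy => by
      have hmem : (gen {(x, y)} : AlgCongruence L A) ∈ S :=
        ⟨{(x, y)}, Set.finite_singleton _, by simpa using hxy, rfl⟩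
      exact le_sSup hmem x y (gen_of_mem (p := (x, y)) rfl)
    have hne : S.Nonempty := ⟨gen ∅, ∅, Set.finite_empty, by simp, rfl⟩
    have hdir : DirectedOn (· ≤ ·) S := by
      rintro _ ⟨P, hP, hPθ, rfl⟩ _ ⟨Q, hQ, hQθ, rfl⟩
      refine ⟨gen (P ∪ Q), ⟨_, hP.union hQ, ?_, rfl⟩,
        gen_le.2 fun p hp => gen_of_mem (Or.inl hp),
        gen_le.2 fun p hp => gen_of_mem (Or.inr hp)⟩
      rintro p (hp | hp)
      · exact hPθ p hp
      · exact hQθ p hp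
    obtain ⟨ψ, ⟨P, hP, hPθ, rfl⟩, hψ⟩ :=
      (CompleteLattice.isCompactElement_iff_le_of_directed_sSup_le _ θ).1 h S hne hdir hle
    exact ⟨P, hP, le_antisymm hψ (gen_le.2 hPθ)⟩
  · rintro ⟨P, hP, rfl⟩
    rw [CompleteLattice.isCompactElement_iff_le_of_directed_sSup_le]
    intro S hne hS hle
    have key : ∀ Q : Set (A × A), Q.Finite → (∀ p ∈ Q, (sSup S).r p.1 p.2) →
        ∃ χ ∈ S, ∀ p ∈ Q, χ.r p.1 p.2 := by
      intro Q hQ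
      induction Q, hQ using Set.Finite.induction_on with
      | empty => exact fun _ => hne.imp fun θ hθ => ⟨hθ, by simp⟩
      | @insert a s _ _ ih =>
        intro h
        obtain ⟨χ, hχ, h₁⟩ := ih fun p hp => h p (Set.mem_insert_of_mem _ hp)
        obtain ⟨ψ, hψ, h₂⟩ := (sSup_r_of_directedOn hne hS _ _).1 (h a (Set.mem_insert _ _))
        obtain ⟨ρ, hρ, h₃, h₄⟩ := hS χ hχ ψ hψ
        refine ⟨ρ, hρ, fun p hp => ?_⟩
        rcases Set.mem_insert_iff.1 hp with rfl | hp
        · exact h₄ _ _ h₂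
        · exact h₃ _ _ (h₁ p hp)
    obtain ⟨χ, hχ, h⟩ := key P hP (gen_le.1 hle)
    exact ⟨χ, hχ, gen_le.2 h⟩

variable {B : Type u} [L.Structure B] {C : Type u} [L.Structure C]

/-- `Con f : Con A → Con B` sends `α` to the congruence of `B` generated by the pairs
`(f x, f y)` with `(x, y) ∈ α`. -/
def map (f : L.Hom A B) (α : AlgCongruence L A) : AlgCongruence L B :=
  gen {q | ∃ x y, α.r x y ∧ q = (f x, f y)}

theorem map_le {f : L.Hom A B} {α : AlgCongruence L A} {β : AlgCongruence L B} :
    map f α ≤ β ↔ ∀ x y, α.r x y → β.r (f x) (f y) := by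
  rw [map, gen_le]
  exact ⟨fun h x y hxy => h _ ⟨x, y, hxy, rfl⟩, by rintro h _ ⟨x, y, hxy, rfl⟩; exact h x y hxy⟩

/-- The inverse image of a congruence under a homomorphism. -/
def comap (f : L.Hom A B) (β : AlgCongruence L B) : AlgCongruence L A where
  r x y := β.r (f x) (f y)
  iseqv := ⟨fun _ => β.iseqv.refl _, fun h => β.iseqv.symm h, fun h h' => β.iseqv.trans h h'⟩
  compat g x y h := by
    rw [FirstOrder.Language.Hom.map_fun, FirstOrder.Language.Hom.map_fun]
    exact β.compat g _ _ h

theorem map_comap_gc (f : L.Hom A B) :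
    GaloisConnection (map f : AlgCongruence L A → AlgCongruence L B) (comap f) :=
  fun _ _ => map_le

theorem map_gen (f : L.Hom A B) (P : Set (A × A)) :
    map f (gen P) = gen (Prod.map f f '' P) := by
  refine le_antisymm ((map_comap_gc f).l_le ?_) (gen_le.2 ?_)
  · exact gen_le.2 fun p hp => gen_of_mem (p := (f p.1, f p.2)) ⟨p, hp, rfl⟩
  · rintro _ ⟨p, hp, rfl⟩
    exact map_le.1 le_rfl p.1 p.2 (gen_of_mem hp)

theorem isCompactElement_map (f : L.Hom A B) {α : AlgCongruence L A} (h : IsCompactElement α) :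
    IsCompactElement (map f α) := by
  obtain ⟨P, hP, rfl⟩ := isCompactElement_iff.1 h
  exact isCompactElement_iff.2 ⟨_, hP.image _, map_gen f P⟩

theorem isCompactElement_sup {α β : AlgCongruence L A} (hα : IsCompactElement α)
    (hβ : IsCompactElement β) : IsCompactElement (α ⊔ β) := by
  obtain ⟨P, hP, rfl⟩ := isCompactElement_iff.1 hα
  obtain ⟨Q, hQ, rfl⟩ := isCompactElement_iff.1 hβ
  refine isCompactElement_iff.2 ⟨P ∪ Q, hP.union hQ, le_antisymm (sup_le ?_ ?_) (gen_le.2 ?_)⟩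
  · exact gen_le.2 fun p hp => gen_of_mem (Or.inl hp)
  · exact gen_le.2 fun p hp => gen_of_mem (Or.inr hp)
  · rintro p (hp | hp)
    · exact (le_sup_left : gen P ≤ gen P ⊔ gen Q) _ _ (gen_of_mem hp)
    · exact (le_sup_right : gen Q ≤ gen P ⊔ gen Q) _ _ (gen_of_mem hp)

theorem isCompactElement_bot : IsCompactElement (⊥ : AlgCongruence L A) :=
  isCompactElement_iff.2
    ⟨∅, Set.finite_empty, le_antisymm bot_le (gen_le.2 fun _ hp => hp.elim)⟩

theorem map_id (α : AlgCongruence L A) : map (FirstOrder.Language.Hom.id L A) α = α :=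
  le_antisymm (map_le.2 fun _ _ h => h) fun x y h => map_le.1 le_rfl x y h

theorem map_comp (g : L.Hom B C) (f : L.Hom A B) (α : AlgCongruence L A) :
    map (g.comp f) α = map g (map f α) :=
  le_antisymm
    (map_le.2 fun x y h => map_le.1 le_rfl _ _ (map_le.1 le_rfl x y h))
    ((map_comap_gc g).l_le ((map_comap_gc f).l_le fun x y h =>
      (map_le.1 le_rfl x y h : (map (g.comp f) α).r (g (f x)) (g (f y)))))

end AlgCongruence

/-! ### The functor of compact congruences -/

/-- The set of all compact congruences of `A`, ordered by inclusion. -/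
abbrev ConcType (L : FirstOrder.Language.{v, w}) (A : Type u) [L.Structure A] : Type u :=
  {α : AlgCongruence L A // IsCompactElement α}

/-- Finite joins of compact congruences are formed in `Con A`. -/
instance (L : FirstOrder.Language.{v, w}) (A : Type u) [L.Structure A] :
    SemilatticeSup (ConcType L A) :=
  Subtype.semilatticeSup fun _ _ => AlgCongruence.isCompactElement_sup

instance (L : FirstOrder.Language.{v, w}) (A : Type u) [L.Structure A] :
    OrderBot (ConcType L A) :=
  Subtype.orderBot AlgCongruence.isCompactElement_bot

/-- The functor `Con_c` from algebras to `(∨, 0)`-semilattices: `Con_c f` is the restriction of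
`Con f` to compact congruences. -/
def Conc (L : FirstOrder.Language.{v, w}) : AlgCat.{u} L ⥤ SemilatSupCat.{u} where
  obj A := SemilatSupCat.of (ConcType L A)
  map {A B} (f : L.Hom A B) :=
    { toFun := fun (α : ConcType L A) =>
        (⟨AlgCongruence.map f α.1, AlgCongruence.isCompactElement_map f α.2⟩ : ConcType L B)
      map_sup' := fun _ _ => Subtype.ext (AlgCongruence.map_comap_gc f).l_sup
      map_bot' := Subtype.ext (AlgCongruence.map_comap_gc f).l_bot }
  map_id _ := SupBotHom.ext fun α => Subtype.ext (AlgCongruence.map_id α.1)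
  map_comp f g := SupBotHom.ext fun α => Subtype.ext (AlgCongruence.map_comp g f α.1)

/-! ### Varieties, local cardinality, liftings -/

/-- A variety of `L`-algebras: the class of all algebras satisfying a given set of identities. -/
def IsVariety {L : FirstOrder.Language.{v, w}} (V : ObjectProperty (AlgCat.{u} L)) : Prop :=
  ∃ E : Set (L.Term ℕ × L.Term ℕ), ∀ A : AlgCat.{u} L,
    V A ↔ ∀ e ∈ E, ∀ x : ℕ → A, e.1.realize x = e.2.realize x

/-- A class of algebras is locally `≤ κ` if every finitely generated subalgebra of every member
has at most `κ` elements. -/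
def LocallyLE {L : FirstOrder.Language.{v, w}} (V : ObjectProperty (AlgCat.{u} L))
    (κ : Cardinal.{u}) : Prop :=
  ∀ A : AlgCat.{u} L, V A → ∀ S : L.Substructure A, S.FG → #S ≤ κ

/-- `D` has a lifting in `V`: there is a functor `F` into (the full subcategory of algebras
belonging to) `V` such that `Con_c ∘ F` is naturally isomorphic to `D`. -/
def HasLifting {L : FirstOrder.Language.{v, w}} (V : ObjectProperty (AlgCat.{u} L))
    {J : Type u} [Category.{u} J] (D : J ⥤ SemilatSupCat.{u}) : Prop :=
  ∃ F : J ⥤ V.FullSubcategory, Nonempty ((F ⋙ V.ι) ⋙ Conc L ≅ D)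

/-- A well-founded tree: a poset with a smallest element in which every principal lower subset
is a well-founded chain. -/
structure IsWellFoundedTree (I : Type u) [PartialOrder I] : Prop where
  exists_least : ∃ b : I, ∀ i, b ≤ i
  isChain : ∀ i : I, IsChain (· ≤ ·) (Set.Iic i)
  isWF : ∀ i : I, (Set.Iic i).IsWF

end CongLift

/-! The `I`-direction of the diagram is coded into one `J`-indexed diagram of size at most `κ`,
carried to `V₂` by the hypothesis on `J`-indexed diagrams, and decoded there. The flexible notion is
that of an ideal-induced map. It is preserved by composition, holds for `Con_c` of a surjection,
passes to suitable small subalgebras, and becomes an isomorphism once the algebra is divided by the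
zero set.

Coding: a Löwenheim–Skolem argument (`exists_small_substructures`) shrinks the lifting in `V₁` to
algebras of size at most `κ` whose compact congruences still map onto `D` by ideal-induced maps. Let
`K` be a set of `κ` colours. The condensate (`exists_condensate`) lies in the product over all
points `(i, s)`, with `s : I → K`, and is generated by at most `κ` elements, so the local bound on
`V₁` keeps it of size at most `κ`. Each point gives a surjection onto the algebra at `i`, and each
element changes along a branch only where one of finitely many colours occurs. `BranchFamily`
records this in terms of `Con_c` alone, so it survives the change of variety.

Decoding: `exists_branch_subalgebras` builds by well-founded recursion a single colouring `s` and
increasing subalgebras. The colour `s i` avoids the finite supports of all principal congruences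
given by pairs from earlier subalgebras. There are fewer than `κ` such pairs, because `↓i` has fewer
than `cf κ` elements and the earlier subalgebras have total size below `κ`, so a colour remains. The
maps to `D` are then natural in `I` as well, and `exists_quotient_diagram` turns them into a
lifting. -/

namespace CongLift

/-! ### Ideal-induced homomorphisms of semilattices -/

/-- A `(∨, 0)`-homomorphism is ideal-induced if it is, up to isomorphism, the quotient map by the
congruence attached to an ideal. -/
structure IdealInduced {S T : Type*} [SemilatticeSup S] [OrderBot S] [SemilatticeSup T]
    [OrderBot T] (r : SupBotHom S T) : Prop where
  surjective : Function.Surjective r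
  exists_sup_eq : ∀ a b, r a = r b → ∃ c, r c = ⊥ ∧ a ⊔ c = b ⊔ c

section IdealInduced

variable {S T U : Type*} [SemilatticeSup S] [OrderBot S] [SemilatticeSup T] [OrderBot T]
  [SemilatticeSup U] [OrderBot U]

theorem IdealInduced.comp {g : SupBotHom T U} {f : SupBotHom S T} (hg : IdealInduced g)
    (hf : IdealInduced f) : IdealInduced (g.comp f) where
  surjective := hg.surjective.comp hf.surjective
  exists_sup_eq a b h := by
    obtain ⟨c, hc, habc⟩ := hg.exists_sup_eq (f a) (f b) h
    obtain ⟨c, rfl⟩ := hf.surjective c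
    rw [← map_sup, ← map_sup] at habc
    obtain ⟨d, hd, h⟩ := hf.exists_sup_eq _ _ habc
    refine ⟨c ⊔ d, ?_, by rw [← sup_assoc, ← sup_assoc, h]⟩
    simp only [SupBotHom.comp_apply] at hc ⊢
    rw [map_sup, map_sup, hc, hd, map_bot, sup_bot_eq]

theorem idealInduced_of_bijective (r : SupBotHom S T) (hr : Function.Bijective r) :
    IdealInduced r where
  surjective := hr.2
  exists_sup_eq a b h := ⟨⊥, map_bot r, by rw [hr.1 h]⟩

theorem IdealInduced.apply_eq_of_apply_eq {p : SupBotHom S T} {r : SupBotHom S U}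
    (hp : IdealInduced p) (h : ∀ a, p a = ⊥ → r a = ⊥) {a b : S} (hab : p a = p b) :
    r a = r b := by
  obtain ⟨c, hc, habc⟩ := hp.exists_sup_eq a b hab
  have := congrArg r habc
  rwa [map_sup, map_sup, h c hc, sup_bot_eq, sup_bot_eq] at this

/-- Two ideal-induced homomorphisms with the same zero set have isomorphic codomains. -/
theorem IdealInduced.exists_orderIso {p : SupBotHom S T} {r : SupBotHom S U}
    (hp : IdealInduced p) (hr : IdealInduced r) (h : ∀ a, p a = ⊥ ↔ r a = ⊥) :
    ∃ e : T ≃o U, ∀ a, e (p a) = r a := by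
  have hpr : ∀ {a b}, p a = p b ↔ r a = r b := fun {a b} =>
    ⟨hp.apply_eq_of_apply_eq fun a => (h a).1, hr.apply_eq_of_apply_eq fun a => (h a).2⟩
  have hle : ∀ {a b}, p a ≤ p b ↔ r a ≤ r b := fun {a b} => by
    rw [← sup_eq_right, ← sup_eq_right, ← map_sup, ← map_sup, hpr]
  let g := Function.surjInv hp.surjective
  have hg : ∀ t, p (g t) = t := Function.surjInv_eq hp.surjective
  have hrg : ∀ a, r (g (p a)) = r a := fun a => hpr.1 (hg _)
  let e : T ≃ U := Equiv.ofBijective (fun t => r (g t))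
    ⟨fun t t' htt' => by rw [← hg t, ← hg t']; exact hpr.2 htt', fun x => by
      obtain ⟨a, rfl⟩ := hr.surjective x
      exact ⟨p a, hrg a⟩⟩
  refine ⟨⟨e, fun {t t'} => ?_⟩, hrg⟩
  change r (g t) ≤ r (g t') ↔ _
  rw [← hle, hg, hg]

end IdealInduced

/-! ### Compact congruences and homomorphisms -/

namespace AlgCongruence

variable {L : FirstOrder.Language.{v, w}} {A : Type u} [L.Structure A] {B : Type u}
  [L.Structure B] {C : Type u} [L.Structure C]

theorem gen_union (P Q : Set (A × A)) :
    (gen (P ∪ Q) : AlgCongruence L A) = gen P ⊔ gen Q := by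
  refine le_antisymm (gen_le.2 ?_) (sup_le ?_ ?_)
  · rintro p (hp | hp)
    · exact (le_sup_left : gen P ≤ gen P ⊔ gen Q) _ _ (gen_of_mem hp)
    · exact (le_sup_right : gen Q ≤ gen P ⊔ gen Q) _ _ (gen_of_mem hp)
  · exact gen_le.2 fun p hp => gen_of_mem (Or.inl hp)
  · exact gen_le.2 fun p hp => gen_of_mem (Or.inr hp)

theorem bot_r {x y : A} : (⊥ : AlgCongruence L A).r x y ↔ x = y := by
  constructor
  · let E : AlgCongruence L A :=
      { r := fun x y => x = y
        iseqv := ⟨fun _ => rfl, Eq.symm, Eq.trans⟩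
        compat := fun f x y h => congrArg _ (funext h) }
    exact fun h => (bot_le : ⊥ ≤ E) x y h
  · rintro rfl
    exact (⊥ : AlgCongruence L A).iseqv.refl x

/-- The kernel of a homomorphism. -/
def ker (f : L.Hom A B) : AlgCongruence L A := comap f ⊥

theorem ker_r {f : L.Hom A B} {x y : A} : (ker f).r x y ↔ f x = f y := bot_r

/-- The correspondence theorem for congruences: a set-theoretic section of `f` is a homomorphism
modulo `ker f`, so `α ⊔ ker f` descends along it to a congruence of `B`. -/
theorem comap_map_of_surjective (f : L.Hom A B) (hf : Function.Surjective f)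
    (α : AlgCongruence L A) : comap f (map f α) = α ⊔ ker f := by
  apply le_antisymm
  · let g := Function.surjInv hf
    have hg : ∀ y, f (g y) = y := Function.surjInv_eq hf
    have hker : ∀ {x y}, f x = f y → (α ⊔ ker f).r x y := fun h =>
      (le_sup_right : ker f ≤ α ⊔ ker f) _ _ (ker_r.2 h)
    let R : AlgCongruence L B :=
      { r := fun x y => (α ⊔ ker f).r (g x) (g y)
        iseqv := ⟨fun _ => (α ⊔ ker f).iseqv.refl _, fun h => (α ⊔ ker f).iseqv.symm h,
          fun h h' => (α ⊔ ker f).iseqv.trans h h'⟩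
        compat := fun {n} F x y h => by
          have key : ∀ z : Fin n → B, f (g (FirstOrder.Language.Structure.funMap F z)) =
              f (FirstOrder.Language.Structure.funMap F (g ∘ z)) := fun z => by
            rw [hg, FirstOrder.Language.Hom.map_fun, ← Function.comp_assoc]
            congr 1
            exact funext fun k => (hg _).symm
          exact (α ⊔ ker f).iseqv.trans (hker (key x)) ((α ⊔ ker f).iseqv.trans
            ((α ⊔ ker f).compat F _ _ h) (hker (key y).symm)) }
    have hR : map f α ≤ R := map_le.2 fun x y h =>
      (α ⊔ ker f).iseqv.trans (hker (hg _)) ((α ⊔ ker f).iseqv.trans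
        ((le_sup_left : α ≤ α ⊔ ker f) _ _ h) (hker (hg _).symm))
    intro x y h
    exact (α ⊔ ker f).iseqv.trans (hker (hg _).symm) ((α ⊔ ker f).iseqv.trans
      (hR _ _ h) (hker (hg _)))
  · refine sup_le (map_le.1 le_rfl) fun x y h => ?_
    rw [ker_r] at h
    change (map f α).r (f x) (f y)
    rw [h]

/-- `θ` is the directed join of its compact lower bounds, and compactness of `α` selects one. This
yields the compact witness required by ideal-inducedness. -/
theorem exists_compact_le_sup {α β θ : AlgCongruence L A} (hα : IsCompactElement α)
    (h : α ≤ β ⊔ θ) : ∃ γ, IsCompactElement γ ∧ γ ≤ θ ∧ α ≤ β ⊔ γ := by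
  let S : Set (AlgCongruence L A) := {ψ | ∃ γ, IsCompactElement γ ∧ γ ≤ θ ∧ ψ = β ⊔ γ}
  have hne : S.Nonempty := ⟨_, ⊥, isCompactElement_bot, bot_le, rfl⟩
  have hdir : DirectedOn (· ≤ ·) S := by
    rintro _ ⟨γ, hγ, hγθ, rfl⟩ _ ⟨δ, hδ, hδθ, rfl⟩
    exact ⟨_, ⟨γ ⊔ δ, isCompactElement_sup hγ hδ, sup_le hγθ hδθ, rfl⟩,
      sup_le_sup_left le_sup_left _, sup_le_sup_left le_sup_right _⟩
  have hle : α ≤ sSup S := by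
    refine h.trans (sup_le ?_ fun x y hxy => ?_)
    · exact le_sup_left.trans (le_sSup (⟨⊥, isCompactElement_bot, bot_le, rfl⟩ : β ⊔ ⊥ ∈ S))
    · have hmem : β ⊔ gen {(x, y)} ∈ S :=
        ⟨_, isCompactElement_iff.2 ⟨_, Set.finite_singleton _, rfl⟩,
          gen_le.2 (by simpa using hxy), rfl⟩
      exact (le_sup_right.trans (le_sSup hmem) : gen {(x, y)} ≤ sSup S) x y
        (gen_of_mem (p := (x, y)) rfl)
  obtain ⟨_, ⟨γ, hγ, hγθ, rfl⟩, hαγ⟩ :=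
    (CompleteLattice.isCompactElement_iff_le_of_directed_sSup_le _ α).1 hα S hne hdir hle
  exact ⟨γ, hγ, hγθ, hαγ⟩

variable (L) in
/-- The compact congruence generated by a finite set of pairs. -/
def genc (P : Set (A × A)) (hP : P.Finite) : ConcType L A :=
  ⟨gen P, isCompactElement_iff.2 ⟨P, hP, rfl⟩⟩

theorem exists_eq_genc (α : ConcType L A) : ∃ (P : Set (A × A)) (hP : P.Finite),
    α = genc L P hP := by
  obtain ⟨α, hα⟩ := α
  obtain ⟨P, hP, rfl⟩ := isCompactElement_iff.1 hα
  exact ⟨P, hP, rfl⟩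

variable (L) in
/-- The principal congruence generated by a pair. -/
def principal (x y : A) : ConcType L A := genc L {(x, y)} (Set.finite_singleton _)

theorem principal_le {x y : A} {α : ConcType L A} : principal L x y ≤ α ↔ α.1.r x y :=
  gen_le.trans (by simp)

theorem genc_le {P : Set (A × A)} {hP : P.Finite} {α : ConcType L A} :
    genc L P hP ≤ α ↔ ∀ p ∈ P, principal L p.1 p.2 ≤ α :=
  gen_le.trans (forall₂_congr fun _ _ => principal_le.symm)

theorem genc_union {P Q : Set (A × A)} (hP : P.Finite) (hQ : Q.Finite) :
    genc L (P ∪ Q) (hP.union hQ) = genc L P hP ⊔ genc L Q hQ :=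
  Subtype.ext (gen_union P Q)

/-- Finitely generated congruences are finite joins of principal ones. -/
theorem genc_induction {p : ConcType L A → Prop} {P : Set (A × A)} (hP : P.Finite) (h₀ : p ⊥)
    (h₁ : ∀ q ∈ P, p (principal L q.1 q.2)) (h₂ : ∀ a b, p a → p b → p (a ⊔ b)) :
    p (genc L P hP) := by
  induction P, hP using Set.Finite.induction_on with
  | empty =>
    have : genc L (∅ : Set (A × A)) Set.finite_empty = ⊥ :=
      le_antisymm (genc_le.2 (by simp)) bot_le
    rwa [this]
  | @insert a s _ hs ih =>
    have : genc L (insert a s) (hs.insert a) = principal L a.1 a.2 ⊔ genc L s hs :=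
      genc_union (Set.finite_singleton a) hs
    rw [this]
    exact h₂ _ _ (h₁ _ (Set.mem_insert _ _))
      (ih fun q hq => h₁ q (Set.mem_insert_of_mem _ hq))

/-- Two homomorphisms from `Con_c A` agreeing at the principal congruences are equal. -/
theorem supBotHom_ext_principal {T : Type*} [SemilatticeSup T] [OrderBot T]
    {φ ψ : SupBotHom (ConcType L A) T}
    (h : ∀ x y, φ (principal L x y) = ψ (principal L x y)) : φ = ψ := by
  refine SupBotHom.ext fun α => ?_
  obtain ⟨P, hP, rfl⟩ := exists_eq_genc α
  refine genc_induction (p := fun α => φ α = ψ α) hP ?_ (fun q _ => h _ _) fun a b ha hb => ?_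
  · rw [map_bot, map_bot]
  · rw [map_sup, map_sup, ha, hb]

/-- `Con_c f` for a homomorphism `f`. -/
def concMap (f : L.Hom A B) : SupBotHom (ConcType L A) (ConcType L B) where
  toFun α := ⟨map f α.1, isCompactElement_map f α.2⟩
  map_sup' _ _ := Subtype.ext (map_comap_gc f).l_sup
  map_bot' := Subtype.ext (map_comap_gc f).l_bot

theorem concMap_comp (g : L.Hom B C) (f : L.Hom A B) (α : ConcType L A) :
    concMap (g.comp f) α = concMap g (concMap f α) :=
  Subtype.ext (map_comp g f α.1)

theorem concMap_genc (f : L.Hom A B) {P : Set (A × A)} (hP : P.Finite) :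
    concMap f (genc L P hP) = genc L (Prod.map f f '' P) (hP.image _) :=
  Subtype.ext (map_gen f P)

theorem concMap_principal (f : L.Hom A B) (x y : A) :
    concMap f (principal L x y) = principal L (f x) (f y) := by
  refine Subtype.ext ((map_gen f _).trans ?_)
  rw [Set.image_singleton]
  rfl

theorem concMap_eq_bot {f : L.Hom A B} {α : ConcType L A} :
    concMap f α = ⊥ ↔ α.1 ≤ ker f := by
  rw [← le_bot_iff]
  exact map_comap_gc f α.1 ⊥

/-- The homomorphism `Con_c f` is ideal-induced whenever `f` is surjective. -/
theorem idealInduced_concMap (f : L.Hom A B) (hf : Function.Surjective f) :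
    IdealInduced (concMap f) where
  surjective β := by
    obtain ⟨P, hP, rfl⟩ := exists_eq_genc β
    let g := Function.surjInv hf
    refine ⟨genc L (Prod.map g g '' P) (hP.image _), Subtype.ext ((map_gen f _).trans ?_)⟩
    have hfg : f ∘ g = id := funext (Function.surjInv_eq hf)
    rw [← Set.image_comp, Prod.map_comp_map, hfg, Prod.map_id, Set.image_id]
    rfl
  exists_sup_eq a b h := by
    have h' : map f a.1 = map f b.1 := congrArg Subtype.val h
    have h₁ : a.1 ≤ b.1 ⊔ ker f := by
      rw [← comap_map_of_surjective f hf, ← h']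
      exact map_le.1 le_rfl
    have h₂ : b.1 ≤ a.1 ⊔ ker f := by
      rw [← comap_map_of_surjective f hf, h']
      exact map_le.1 le_rfl
    obtain ⟨c, hc, hcf, hac⟩ := exists_compact_le_sup a.2 h₁
    obtain ⟨d, hd, hdf, hbd⟩ := exists_compact_le_sup b.2 h₂
    refine ⟨⟨c, hc⟩ ⊔ ⟨d, hd⟩, concMap_eq_bot.2 (sup_le hcf hdf), le_antisymm ?_ ?_⟩
    · exact sup_le (hac.trans (sup_le_sup_left le_sup_left _)) le_sup_right
    · exact sup_le (hbd.trans (sup_le_sup_left le_sup_right _)) le_sup_right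

/-! ### The quotient by the zero set of a homomorphism -/

variable {T : Type*} [SemilatticeSup T] [OrderBot T]

/-- The congruence of all pairs whose principal congruence is sent to `⊥`. -/
def zeroSet (r : SupBotHom (ConcType L A) T) : AlgCongruence L A where
  r x y := r (principal L x y) = ⊥
  iseqv := by
    have mono : ∀ {a b}, a ≤ b → r b = ⊥ → r a = ⊥ := fun {a b} h hb =>
      le_bot_iff.1 (hb ▸ OrderHomClass.mono r h)
    refine ⟨fun x => ?_, fun {x y} h => mono ?_ h, fun {x y z} h h' => ?_⟩
    · have : principal L x x = ⊥ := le_bot_iff.1 (principal_le.2 (bot_r.2 rfl))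
      rw [this, map_bot]
    · exact principal_le.2 ((principal L x y).1.iseqv.symm (principal_le.1 le_rfl))
    · have hs : r (principal L x y ⊔ principal L y z) = ⊥ := by
        rw [map_sup, h, h', sup_bot_eq]
      exact mono (principal_le.2 ((principal L x y ⊔ principal L y z).1.iseqv.trans
        (principal_le.1 le_sup_left) (principal_le.1 le_sup_right))) hs
  compat {n} f x y h := by
    let σ : ConcType L A := Finset.univ.sup fun k : Fin n => principal L (x k) (y k)
    have hσ : r σ = ⊥ := by
      rw [map_finset_sup]
      exact (Finset.sup_eq_bot_iff _ _).2 fun k _ => h k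
    have hle : principal L (FirstOrder.Language.Structure.funMap f x)
        (FirstOrder.Language.Structure.funMap f y) ≤ σ :=
      principal_le.2 (σ.1.compat f x y fun k => principal_le.1
        (Finset.le_sup (f := fun k : Fin n => principal L (x k) (y k)) (Finset.mem_univ k)))
    exact le_bot_iff.1 (hσ ▸ OrderHomClass.mono r hle)

/-- Compact congruences are finite joins of principal ones, so the elements killed by `r` are
determined by the principal congruences it kills. -/
theorem le_zeroSet_iff {r : SupBotHom (ConcType L A) T} {α : ConcType L A} :
    α.1 ≤ zeroSet r ↔ r α = ⊥ := by
  constructor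
  · intro h
    obtain ⟨P, hP, rfl⟩ := exists_eq_genc α
    refine genc_induction (p := fun α => r α = ⊥) hP (map_bot r) (fun q hq => ?_) fun a b ha hb => ?_
    · exact h _ _ (gen_of_mem hq)
    · rw [map_sup, ha, hb, sup_bot_eq]
  · intro h x y hxy
    exact le_bot_iff.1 (h ▸ OrderHomClass.mono r (principal_le.2 hxy))

variable [L.IsAlgebraic]

/-- Operations are computed on chosen representatives; compatibility of `θ` makes the choice
immaterial. -/
noncomputable instance quotientStructure (θ : AlgCongruence L A) : L.Structure (Quotient θ.toSetoid) where
  funMap f x := Quotient.mk _ (FirstOrder.Language.Structure.funMap f fun k => (x k).out)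
  RelMap r := isEmptyElim r

/-- The canonical projection to the quotient. -/
noncomputable def proj (θ : AlgCongruence L A) : L.Hom A (Quotient θ.toSetoid) where
  toFun := Quotient.mk _
  map_fun' f x := Quotient.sound (θ.compat f _ _ fun k => θ.iseqv.symm (Quotient.mk_out (x k)))
  map_rel' r := isEmptyElim r

theorem proj_surjective (θ : AlgCongruence L A) : Function.Surjective (proj θ) :=
  Quotient.mk_surjective

theorem proj_eq_iff {θ : AlgCongruence L A} {x y : A} : proj θ x = proj θ y ↔ θ.r x y :=
  Quotient.eq

theorem ker_proj (θ : AlgCongruence L A) : ker (proj θ) = θ :=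
  ext_r fun _ _ => ker_r.trans proj_eq_iff

/-- The homomorphism between quotients induced by a homomorphism. -/
noncomputable def quotientMap (f : L.Hom A B) (θ : AlgCongruence L A) (ψ : AlgCongruence L B)
    (h : θ ≤ comap f ψ) : L.Hom (Quotient θ.toSetoid) (Quotient ψ.toSetoid) where
  toFun := Quotient.map f h
  map_fun' {n} F x := by
    change Quotient.mk _ (f _) = Quotient.mk _ _
    rw [FirstOrder.Language.Hom.map_fun]
    refine Quotient.sound (ψ.compat F _ _ fun k => ?_)
    refine Quotient.exact (s := ψ.toSetoid) ?_
    simp only [Function.comp, Quotient.out_eq]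
    conv_rhs => rw [← Quotient.out_eq (x k)]
    rfl
  map_rel' r := isEmptyElim r

theorem quotientMap_proj (f : L.Hom A B) (θ : AlgCongruence L A) (ψ : AlgCongruence L B)
    (h : θ ≤ comap f ψ) (x : A) : quotientMap f θ ψ h (proj θ x) = proj ψ (f x) := rfl

/-- Both `r` and `Con_c` of the projection are ideal-induced, with the same zero set. -/
theorem exists_conc_quotient_iso (r : SupBotHom (ConcType L A) T) (hr : IdealInduced r) :
    ∃ e : ConcType L (Quotient (zeroSet r).toSetoid) ≃o T,
      ∀ α, e (concMap (proj (zeroSet r)) α) = r α :=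
  (idealInduced_concMap _ (proj_surjective _)).exists_orderIso hr fun α => by
    rw [concMap_eq_bot, ker_proj, le_zeroSet_iff]

end AlgCongruence

/-! ### Closing a set under finitary operations -/

theorem mk_iUnion_le_of_le {ι T : Type u} {μ : Cardinal.{u}} (hμ : ℵ₀ ≤ μ) (hι : #ι ≤ μ)
    (s : ι → Set T) (hs : ∀ i, #(s i) ≤ μ) : #(⋃ i, s i) ≤ μ := by
  refine (mk_iUnion_le_sum_mk).trans ((sum_le_sum _ _ hs).trans ?_)
  rw [sum_const']
  exact (mul_le_mul' hι le_rfl).trans (mul_eq_self hμ).le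

theorem mk_finset_le_max (T : Type u) : #(Finset T) ≤ max ℵ₀ #T := by
  classical
  exact (mk_le_of_surjective (f := List.toFinset) List.toFinset_surjective).trans
    (mk_list_le_max T)

/-- A set of cardinality at most `μ` is contained in a set of cardinality at most `μ` which is
closed under a given finitary set-valued operation with values of cardinality at most `μ`. -/
theorem exists_closed_superset {T : Type u} {μ : Cardinal.{u}} (hμ : ℵ₀ ≤ μ)
    (d : Finset T → Set T) (hd : ∀ Φ, #(d Φ) ≤ μ) (X₀ : Set T) (hX₀ : #X₀ ≤ μ) :
    ∃ X : Set T, X₀ ⊆ X ∧ #X ≤ μ ∧ ∀ Φ : Finset T, ↑Φ ⊆ X → d Φ ⊆ X := by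
  classical
  -- One round of closure; `X` is the union of `ω` rounds, and a finite subset of the union already
  -- lies in one round.
  let N : Set T → Set T := fun X => X ∪ ⋃ Φ : Finset X, d (Φ.map (Function.Embedding.subtype _))
  have hN : ∀ X : Set T, #X ≤ μ → #(N X) ≤ μ := fun X hX =>
    (mk_union_le _ _).trans (add_le_of_le hμ hX (mk_iUnion_le_of_le hμ
      ((mk_finset_le_max X).trans (max_le hμ hX)) _ fun Φ => hd _))
  let Y : ℕ → Set T := fun n => N^[n] X₀
  have hY : ∀ n, Y (n + 1) = N (Y n) := fun n => Function.iterate_succ_apply' N n X₀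
  have hmono : Monotone Y := monotone_nat_of_le_succ fun n => by
    rw [hY]
    exact Set.subset_union_left
  have hcard : ∀ n, #(Y n) ≤ μ := fun n => by
    induction n with
    | zero => exact hX₀
    | succ n ih => rw [hY]; exact hN _ ih
  refine ⟨⋃ n : ULift.{u} ℕ, Y n.down, ?_, ?_, ?_⟩
  · exact Set.subset_iUnion (fun n : ULift.{u} ℕ => Y n.down) ⟨0⟩
  · exact mk_iUnion_le_of_le hμ (by simpa using hμ) _ fun n => hcard _
  · intro Φ hΦ
    have hex : ∃ n, ↑Φ ⊆ Y n := by
      have : ∀ t : Φ, ∃ n, (t : T) ∈ Y n := fun t => by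
        obtain ⟨n, hn⟩ := Set.mem_iUnion.1 (hΦ t.2)
        exact ⟨n.down, hn⟩
      choose n hn using this
      exact ⟨Finset.univ.sup n, fun t ht =>
        hmono (Finset.le_sup (Finset.mem_univ (⟨t, ht⟩ : Φ))) (hn ⟨t, ht⟩)⟩
    obtain ⟨n, hn⟩ := hex
    refine Set.Subset.trans ?_ (Set.subset_iUnion (fun n : ULift.{u} ℕ => Y n.down) ⟨n + 1⟩)
    change d Φ ⊆ Y (n + 1)
    rw [hY]
    refine Set.Subset.trans ?_ Set.subset_union_right
    have hΦn : (Φ.subtype (· ∈ Y n)).map (Function.Embedding.subtype _) = Φ :=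
      Finset.subtype_map_of_mem fun t ht => hn ht
    refine Set.Subset.trans (subset_of_eq ?_) (Set.subset_iUnion
      (fun Φ : Finset (Y n) => d (Φ.map (Function.Embedding.subtype _))) (Φ.subtype (· ∈ Y n)))
    exact congrArg d hΦn.symm

/-- Operations are finitary, so closing under the subalgebras generated by finite subsets is enough,
and these are small by hypothesis. -/
theorem mk_substructure_closure_le {L : FirstOrder.Language.{v, w}} {A : Type u} [L.Structure A]
    {μ : Cardinal.{u}} (hμ : ℵ₀ ≤ μ) (hA : ∀ S : L.Substructure A, S.FG → #S ≤ μ) (s : Set A)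
    (hs : #s ≤ μ) : #(FirstOrder.Language.Substructure.closure L s) ≤ μ := by
  obtain ⟨X, hsX, hX, hcl⟩ := exists_closed_superset hμ
    (fun Φ : Finset A => (FirstOrder.Language.Substructure.closure L (Φ : Set A) : Set A))
    (fun Φ => hA _ (FirstOrder.Language.Substructure.fg_closure Φ.finite_toSet)) s hs
  classical
  let S : L.Substructure A :=
    { carrier := X
      fun_mem := fun {n} f x hx => by
        refine hcl (Finset.univ.image x) (by simpa [Set.subset_def] using hx) ?_
        exact FirstOrder.Language.Substructure.fun_mem _ f x fun k =>
          FirstOrder.Language.Substructure.subset_closure (by simp) }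
  exact (mk_le_mk_of_subset (FirstOrder.Language.Substructure.closure_le.2 hsX :
    FirstOrder.Language.Substructure.closure L s ≤ S)).trans hX

/-! ### Congruences of subalgebras -/

namespace AlgCongruence

variable {L : FirstOrder.Language.{v, w}} {A : Type u} [L.Structure A]

/-- The congruence of a subalgebra generated by the pairs of `P` which lie in the subalgebra. -/
def genIn (S : L.Substructure A) (P : Set (A × A)) : AlgCongruence L S :=
  gen (Prod.map (↑) (↑) ⁻¹' P)

theorem finite_preimage_prodMap (S : L.Substructure A) {P : Set (A × A)} (hP : P.Finite) :
    (Prod.map ((↑) : S → A) ((↑) : S → A) ⁻¹' P).Finite :=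
  hP.preimage (Subtype.val_injective.prodMap Subtype.val_injective).injOn

/-- `genIn` as a compact congruence. -/
def gencIn (S : L.Substructure A) (P : Set (A × A)) (hP : P.Finite) : ConcType L S :=
  genc L _ (finite_preimage_prodMap S hP)

theorem image_preimage_prodMap (S : L.Substructure A) {P : Set (A × A)}
    (h : ∀ p ∈ P, p.1 ∈ S ∧ p.2 ∈ S) :
    Prod.map S.subtype.toHom S.subtype.toHom '' (Prod.map ((↑) : S → A) ((↑) : S → A) ⁻¹' P) =
      P := by
  refine Set.image_preimage_eq_of_subset fun p hp => ?_
  exact ⟨(⟨p.1, (h p hp).1⟩, ⟨p.2, (h p hp).2⟩), rfl⟩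

theorem concMap_gencIn (S : L.Substructure A) {P : Set (A × A)} (hP : P.Finite)
    (h : ∀ p ∈ P, p.1 ∈ S ∧ p.2 ∈ S) :
    concMap S.subtype.toHom (gencIn S P hP) = genc L P hP := by
  refine (concMap_genc _ _).trans ?_
  congr 1
  exact image_preimage_prodMap S h

/-- A congruence of a subalgebra generated by a finite set of pairs is `genIn` of the image. -/
theorem exists_eq_gencIn {S : L.Substructure A} (α : ConcType L S) :
    ∃ (P : Set (A × A)) (hP : P.Finite), (∀ p ∈ P, p.1 ∈ S ∧ p.2 ∈ S) ∧ α = gencIn S P hP := by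
  obtain ⟨P, hP, rfl⟩ := exists_eq_genc α
  refine ⟨Prod.map (↑) (↑) '' P, hP.image _, ?_, ?_⟩
  · rintro _ ⟨p, -, rfl⟩
    exact ⟨p.1.2, p.2.2⟩
  · refine Subtype.ext (congrArg gen ?_)
    exact (Set.preimage_image_eq _ (Subtype.val_injective.prodMap Subtype.val_injective)).symm

/-- Membership in a generated congruence is witnessed in all subalgebras containing some finite
set. -/
theorem exists_finite_forall_genIn_r {P : Set (A × A)} {x y : A}
    (h : (gen P : AlgCongruence L A).r x y) :
    ∃ W : Set A, W.Finite ∧ ∀ S : L.Substructure A, W ⊆ S →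
      ∃ (hx : x ∈ S) (hy : y ∈ S), (genIn S P).r ⟨x, hx⟩ ⟨y, hy⟩ := by
  -- The witnessed pairs themselves form a congruence containing `P`, which replaces explicit
  -- Mal'cev chains.
  let R : AlgCongruence L A :=
    { r := fun x y => ∃ W : Set A, W.Finite ∧ ∀ S : L.Substructure A, W ⊆ S →
        ∃ (hx : x ∈ S) (hy : y ∈ S), (genIn S P).r ⟨x, hx⟩ ⟨y, hy⟩
      iseqv :=
        ⟨fun x => ⟨{x}, Set.finite_singleton x, fun S hS =>
            ⟨hS rfl, hS rfl, (genIn S P).iseqv.refl _⟩⟩,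
          fun ⟨W, hW, h⟩ => ⟨W, hW, fun S hS =>
            let ⟨hx, hy, h⟩ := h S hS
            ⟨hy, hx, (genIn S P).iseqv.symm h⟩⟩,
          fun ⟨W, hW, h⟩ ⟨W', hW', h'⟩ => ⟨W ∪ W', hW.union hW', fun S hS =>
            let ⟨hx, _, h⟩ := h S (Set.subset_union_left.trans hS)
            let ⟨_, hz, h'⟩ := h' S (Set.subset_union_right.trans hS)
            ⟨hx, hz, (genIn S P).iseqv.trans h h'⟩⟩⟩
      compat := fun {n} f x y h => by
        choose W hW h using h
        refine ⟨⋃ k, W k, Set.finite_iUnion hW, fun S hS => ?_⟩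
        choose hx hy h using fun k => h k S ((Set.subset_iUnion W k).trans hS)
        exact ⟨S.fun_mem f x hx, S.fun_mem f y hy,
          (genIn S P).compat f (fun k => ⟨x k, hx k⟩) (fun k => ⟨y k, hy k⟩) h⟩ }
  have hR : gen P ≤ R := gen_le.2 fun p hp =>
    ⟨{p.1, p.2}, (Set.finite_singleton _).insert _, fun S hS =>
      ⟨hS (Or.inl rfl), hS (Or.inr rfl), gen_of_mem
        (p := ((⟨p.1, hS (Or.inl rfl)⟩ : S), (⟨p.2, hS (Or.inr rfl)⟩ : S))) hp⟩⟩
  exact hR x y h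

theorem exists_finite_forall_genIn_le {P Q : Set (A × A)} (hP : P.Finite)
    (h : (gen P : AlgCongruence L A) ≤ gen Q) :
    ∃ W : Set A, W.Finite ∧ ∀ S : L.Substructure A, W ⊆ S → genIn S P ≤ genIn S Q := by
  choose W hW hr using fun p : P =>
    exists_finite_forall_genIn_r (gen_le.1 h p.1 p.2)
  have := hP.to_subtype
  refine ⟨⋃ p, W p, Set.finite_iUnion hW, fun S hS => gen_le.2 fun p hp => ?_⟩
  obtain ⟨_, _, h⟩ := hr ⟨_, hp⟩ S ((Set.subset_iUnion W _).trans hS)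
  exact h

variable {T : Type*} [SemilatticeSup T] [OrderBot T]

/-- A finite set of elements forcing the inclusion of a subalgebra to inherit one instance of the
ideal-inducedness of `q`. -/
theorem exists_finite_forall_sup_eq {q : SupBotHom (ConcType L A) T} (hq : IdealInduced q)
    {P Q : Set (A × A)} (hP : P.Finite) (hQ : Q.Finite) (h : q (genc L P hP) = q (genc L Q hQ)) :
    ∃ W : Set A, W.Finite ∧ ∀ S : L.Substructure A, W ⊆ S →
      ∃ γ : ConcType L S, q (concMap S.subtype.toHom γ) = ⊥ ∧
        gencIn S P hP ⊔ γ = gencIn S Q hQ ⊔ γ := by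
  obtain ⟨γ, hγ, hPQ⟩ := hq.exists_sup_eq _ _ h
  obtain ⟨R, hR, rfl⟩ := exists_eq_genc γ
  rw [← genc_union, ← genc_union] at hPQ
  have hPQ' : (gen (P ∪ R) : AlgCongruence L A) = gen (Q ∪ R) := congrArg Subtype.val hPQ
  obtain ⟨W₁, hW₁, h₁⟩ := exists_finite_forall_genIn_le (hP.union hR) hPQ'.le
  obtain ⟨W₂, hW₂, h₂⟩ := exists_finite_forall_genIn_le (hQ.union hR) hPQ'.ge
  -- The coordinates of `R` are added so that the congruence generated by `R` inside `S` extends to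
  -- `genc L R hR`, which `q` kills.
  refine ⟨(W₁ ∪ W₂) ∪ (Prod.fst '' R ∪ Prod.snd '' R),
    (hW₁.union hW₂).union ((hR.image _).union (hR.image _)), fun S hS => ⟨gencIn S R hR, ?_, ?_⟩⟩
  · rw [concMap_gencIn, hγ]
    exact fun p hp => ⟨hS (Or.inr (Or.inl ⟨p, hp, rfl⟩)), hS (Or.inr (Or.inr ⟨p, hp, rfl⟩))⟩
  · rw [gencIn, gencIn, gencIn, ← genc_union, ← genc_union]
    exact Subtype.ext (le_antisymm (h₁ S fun x hx => hS (Or.inl (Or.inl hx)))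
      (h₂ S fun x hx => hS (Or.inl (Or.inr hx))))

end AlgCongruence

/-! ### Small subfunctors -/

open AlgCongruence

variable {L : FirstOrder.Language.{v, w}}

/-- The homomorphism of algebras underlying a morphism of `AlgCat`. -/
abbrev AlgCat.hom {A B : AlgCat.{u} L} (f : A ⟶ B) : L.Hom A B := f

/-- Löwenheim–Skolem for a whole diagram: ideal-inducedness of a restriction needs only finitely
many witnesses for each pair of finite sets of generators, so closing under operations, transition
maps and witnesses costs at most `μ`. -/
theorem exists_small_substructures {J : Type u} [SmallCategory J] (F : J ⥤ AlgCat.{u} L)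
    {μ : Cardinal.{u}} (hμ : ℵ₀ ≤ μ) (hJ : #(Arrow J) ≤ μ)
    (hF : ∀ j, ∀ S : L.Substructure (F.obj j), S.FG → #S ≤ μ)
    (D : J → SemilatSupCat.{u}) (q : ∀ j, SupBotHom (ConcType L (F.obj j)) (D j))
    (hq : ∀ j, IdealInduced (q j)) (hD : Cardinal.sum (fun j => #(D j)) ≤ μ)
    (X₀ : ∀ j, Set (F.obj j)) (hX₀ : Cardinal.sum (fun j => #(X₀ j)) ≤ μ) :
    ∃ S : ∀ j, L.Substructure (F.obj j), (∀ j, X₀ j ⊆ S j) ∧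
      (∀ ⦃j j'⦄ (f : j ⟶ j'), ∀ x ∈ S j, AlgCat.hom (F.map f) x ∈ S j') ∧
      (∀ j, Nonempty (S j)) ∧ Cardinal.sum (fun j => #(S j)) ≤ μ ∧
      ∀ j, IdealInduced ((q j).comp (concMap (S j).subtype.toHom)) := by
  classical
  have hJ' : #J ≤ μ := (mk_le_of_injective (f := fun j : J => Arrow.mk (𝟙 j))
    fun j j' h => congrArg (fun f : Arrow J => f.left) h).trans hJ
  have hfin : ∀ {T : Type u} {s : Set T}, s.Finite → #s ≤ μ := fun hs =>
    (hs.lt_aleph0).le.trans hμ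
  -- generators of compact congruences representing all elements of the codomains
  choose G hG hqG using fun (j : J) (t : D j) =>
    (show ∃ (P : Set (F.obj j × F.obj j)) (hP : P.Finite), q j (genc L P hP) = t by
      obtain ⟨α, rfl⟩ := (hq j).surjective t
      obtain ⟨P, hP, rfl⟩ := exists_eq_genc α
      exact ⟨P, hP, rfl⟩)
  -- witnesses for ideal-inducedness
  choose W hW hWS using fun (j : J) (P Q : Set (F.obj j × F.obj j)) =>
    (show ∃ W : Set (F.obj j), W.Finite ∧ ∀ (hP : P.Finite) (hQ : Q.Finite),
        q j (genc L P hP) = q j (genc L Q hQ) → ∀ S : L.Substructure (F.obj j), W ⊆ S →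
          ∃ γ : ConcType L S, q j (concMap S.subtype.toHom γ) = ⊥ ∧
            gencIn S P hP ⊔ γ = gencIn S Q hQ ⊔ γ by
      by_cases h : ∃ (hP : P.Finite) (hQ : Q.Finite), q j (genc L P hP) = q j (genc L Q hQ)
      · obtain ⟨hP, hQ, h⟩ := h
        obtain ⟨W, hW, h'⟩ := exists_finite_forall_sup_eq (hq j) hP hQ h
        exact ⟨W, hW, fun _ _ _ => h'⟩
      · exact ⟨∅, Set.finite_empty, fun hP hQ h' => (h ⟨hP, hQ, h'⟩).elim⟩)
  -- All components are closed off simultaneously inside their disjoint union. Below, `d₁` handles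
  -- operations, `d₂` transition maps and `d₃` the witnesses `W`.
  let T := Σ j, (F.obj j).carrier
  let mk : ∀ j, F.obj j → T := fun j x => ⟨j, x⟩
  have hmk : ∀ j, Function.Injective (mk j) := fun j => sigma_mk_injective (β := fun j => (F.obj j).carrier)
  let fib : Finset T → ∀ j, Set (F.obj j) := fun Φ j => mk j ⁻¹' (Φ : Set T)
  have hfib : ∀ Φ j, (fib Φ j).Finite := fun Φ j =>
    Φ.finite_toSet.preimage (hmk j).injOn
  let d₁ : Finset T → Set T := fun Φ =>
    ⋃ j, mk j '' (FirstOrder.Language.Substructure.closure L (fib Φ j) : Set (F.obj j))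
  let d₂ : Finset T → Set T := fun Φ =>
    ⋃ f : Arrow J, (fun x => ⟨f.right, AlgCat.hom (F.map f.hom) x⟩) '' fib Φ f.left
  let d₃ : Finset T → Set T := fun Φ =>
    ⋃ j, mk j '' ⋃ P ∈ {P | P ⊆ fib Φ j ×ˢ fib Φ j},
      ⋃ Q ∈ {Q | Q ⊆ fib Φ j ×ˢ fib Φ j}, W j P Q
  have hd : ∀ Φ, #(d₁ Φ ∪ d₂ Φ ∪ d₃ Φ : Set T) ≤ μ := fun Φ => by
    refine (mk_union_le _ _).trans (add_le_of_le hμ ((mk_union_le _ _).trans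
      (add_le_of_le hμ ?_ ?_)) ?_)
    · exact mk_iUnion_le_of_le hμ hJ' _ fun j => mk_image_le.trans
        (hF j _ (FirstOrder.Language.Substructure.fg_closure (hfib Φ j)))
    · exact mk_iUnion_le_of_le hμ hJ _ fun f => hfin ((hfib Φ _).image _)
    · have hp : ∀ j, {P : Set (F.obj j × F.obj j) | P ⊆ fib Φ j ×ˢ fib Φ j}.Finite := fun j =>
        ((hfib Φ j).prod (hfib Φ j)).finite_subsets
      exact mk_iUnion_le_of_le hμ hJ' _ fun j => hfin (((hp j).biUnion fun P _ =>
        (hp j).biUnion fun Q _ => hW j P Q).image _)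
  -- The starting set holds the prescribed `X₀`, one point per component for nonemptiness, and
  -- generators reaching every element of `D j` for surjectivity.
  let Y₀ : Set T := (⋃ j, mk j '' X₀ j) ∪ (⋃ j, {⟨j, Classical.arbitrary _⟩}) ∪
    ⋃ t : Σ j, D j, mk t.1 '' (Prod.fst '' G t.1 t.2 ∪ Prod.snd '' G t.1 t.2)
  have hY₀ : #Y₀ ≤ μ := by
    refine (mk_union_le _ _).trans (add_le_of_le hμ ((mk_union_le _ _).trans
      (add_le_of_le hμ ?_ ?_)) ?_)
    · exact (mk_iUnion_le_sum_mk).trans ((sum_le_sum _ _ fun j => mk_image_le).trans hX₀)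
    · exact mk_iUnion_le_of_le hμ hJ' _ fun j => hfin (Set.finite_singleton _)
    · exact mk_iUnion_le_of_le hμ ((mk_sigma _).trans_le hD) _ fun t =>
        hfin ((((hG _ _).image _).union ((hG _ _).image _)).image _)
  obtain ⟨X, hYX, hX, hcl⟩ := exists_closed_superset hμ _ hd Y₀ hY₀
  have hΦ : ∀ j (s : Set (F.obj j)), s.Finite → s ⊆ mk j ⁻¹' X →
      ∃ Φ : Finset T, ↑Φ ⊆ X ∧ fib Φ j = s := fun j s hs hsX => by
    refine ⟨(hs.image (mk j)).toFinset, ?_, ?_⟩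
    · rwa [Set.Finite.coe_toFinset, Set.image_subset_iff]
    · change mk j ⁻¹' _ = s
      rw [Set.Finite.coe_toFinset, Set.preimage_image_eq _ (hmk j)]
  let S : ∀ j, L.Substructure (F.obj j) := fun j =>
    { carrier := mk j ⁻¹' X
      fun_mem := fun {n} f x hx => by
        obtain ⟨Φ, hΦX, hΦ⟩ := hΦ j (Set.range x) (Set.finite_range x)
          (Set.range_subset_iff.2 hx)
        refine hcl Φ hΦX (Or.inl (Or.inl (Set.mem_iUnion.2 ⟨j, _,
          FirstOrder.Language.Substructure.fun_mem _ f x fun k =>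
            FirstOrder.Language.Substructure.subset_closure ?_, rfl⟩)))
        rw [hΦ]
        exact Set.mem_range_self k }
  refine ⟨S, fun j x hx => ?_, fun j j' f x hx => ?_, fun j => ?_, ?_, fun j => ⟨fun t => ?_, ?_⟩⟩
  · exact hYX (Or.inl (Or.inl (Set.mem_iUnion.2 ⟨j, x, hx, rfl⟩)))
  · obtain ⟨Φ, hΦX, hΦ⟩ := hΦ j {x} (Set.finite_singleton x) (Set.singleton_subset_iff.2 hx)
    refine hcl Φ hΦX (Or.inl (Or.inr (Set.mem_iUnion.2 ⟨Arrow.mk f, x, ?_, rfl⟩)))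
    change x ∈ fib Φ j
    rw [hΦ]
    rfl
  · exact ⟨⟨_, hYX (Or.inl (Or.inr (Set.mem_iUnion.2 ⟨j, rfl⟩)))⟩⟩
  · rw [← mk_sigma]
    refine (mk_le_of_injective (f := fun t : Σ j, S j => (⟨⟨t.1, t.2.1⟩, t.2.2⟩ : X)) ?_).trans hX
    rintro ⟨j, x, hx⟩ ⟨j', x', hx'⟩ h
    obtain ⟨rfl, h⟩ := Sigma.mk.inj (Subtype.mk.inj h)
    obtain rfl := eq_of_heq h
    rfl
  · refine ⟨gencIn (S j) (G j t) (hG j t), ?_⟩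
    rw [SupBotHom.comp_apply, concMap_gencIn, hqG]
    exact fun p hp => ⟨hYX (Or.inr (Set.mem_iUnion.2 ⟨⟨j, t⟩, _, Or.inl ⟨p, hp, rfl⟩, rfl⟩)),
      hYX (Or.inr (Set.mem_iUnion.2 ⟨⟨j, t⟩, _, Or.inr ⟨p, hp, rfl⟩, rfl⟩))⟩
  · intro α β h
    obtain ⟨P, hP, hPS, rfl⟩ := exists_eq_gencIn α
    obtain ⟨Q, hQ, hQS, rfl⟩ := exists_eq_gencIn β
    rw [SupBotHom.comp_apply, SupBotHom.comp_apply, concMap_gencIn _ _ hPS,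
      concMap_gencIn _ _ hQS] at h
    refine hWS j P Q hP hQ h (S j) fun x hx => ?_
    have hPQ := hP.union hQ
    obtain ⟨Φ, hΦX, hΦ⟩ := hΦ j (Prod.fst '' (P ∪ Q) ∪ Prod.snd '' (P ∪ Q))
      ((hPQ.image _).union (hPQ.image _)) (by
        rintro _ (⟨p, hp | hp, rfl⟩ | ⟨p, hp | hp, rfl⟩)
        exacts [(hPS p hp).1, (hQS p hp).1, (hPS p hp).2, (hQS p hp).2])
    refine hcl Φ hΦX (Or.inr (Set.mem_iUnion.2 ⟨j, x, Set.mem_biUnion (x := P) ?_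
      (Set.mem_biUnion (x := Q) ?_ hx), rfl⟩))
    · change P ⊆ _
      rw [hΦ]
      exact fun p hp => ⟨Or.inl ⟨p, Or.inl hp, rfl⟩, Or.inr ⟨p, Or.inl hp, rfl⟩⟩
    · change Q ⊆ _
      rw [hΦ]
      exact fun p hp => ⟨Or.inl ⟨p, Or.inr hp, rfl⟩, Or.inr ⟨p, Or.inr hp, rfl⟩⟩

/-! ### Closure properties of varieties -/

/-- Identities can be tested after a point-separating family of homomorphisms; this covers
subalgebras and products at once. -/
theorem IsVariety.of_jointly_injective {V : ObjectProperty (AlgCat.{u} L)} (hV : IsVariety V)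
    {B : AlgCat.{u} L} {X : Type*} (A : X → AlgCat.{u} L) (f : ∀ x, L.Hom B (A x))
    (hf : ∀ b b', (∀ x, f x b = f x b') → b = b') (hA : ∀ x, V (A x)) : V B := by
  obtain ⟨E, hE⟩ := hV
  refine (hE B).2 fun e he y => hf _ _ fun x => ?_
  rw [← FirstOrder.Language.HomClass.realize_term, ← FirstOrder.Language.HomClass.realize_term]
  exact (hE _).1 (hA x) e he _

theorem IsVariety.of_surjective {V : ObjectProperty (AlgCat.{u} L)} (hV : IsVariety V)
    {A B : AlgCat.{u} L} (f : L.Hom A B) (hf : Function.Surjective f) (hA : V A) : V B := by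
  obtain ⟨E, hE⟩ := hV
  refine (hE B).2 fun e he y => ?_
  obtain ⟨x, rfl⟩ := hf.comp_left y
  rw [FirstOrder.Language.HomClass.realize_term, FirstOrder.Language.HomClass.realize_term]
  exact congrArg f ((hE _).1 hA e he x)

/-! ### Subfunctors -/

section Subfunctor

variable {J : Type u} [SmallCategory J]

/-- The subfunctor given by a family of subalgebras closed under the transition maps. -/
def subFunctor (F : J ⥤ AlgCat.{u} L) (S : ∀ j, L.Substructure (F.obj j))
    (hS : ∀ ⦃j j'⦄ (f : j ⟶ j'), ∀ x ∈ S j, AlgCat.hom (F.map f) x ∈ S j')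
    (hne : ∀ j, Nonempty (S j)) : J ⥤ AlgCat.{u} L where
  obj j := { carrier := S j, nonempty := hne j }
  map {j j'} f := ((AlgCat.hom (F.map f)).domRestrict (S j)).codRestrict (S j')
    fun x => hS f x.1 x.2
  map_id j := FirstOrder.Language.Hom.ext fun x => Subtype.ext <| by
    change AlgCat.hom (F.map (𝟙 j)) x.1 = x.1
    rw [F.map_id]
    rfl
  map_comp f g := FirstOrder.Language.Hom.ext fun x => Subtype.ext <| by
    change AlgCat.hom (F.map (f ≫ g)) x.1 = _
    rw [F.map_comp]
    rfl

/-- The inclusion of a subfunctor. -/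
def subFunctorι (F : J ⥤ AlgCat.{u} L) (S : ∀ j, L.Substructure (F.obj j))
    (hS : ∀ ⦃j j'⦄ (f : j ⟶ j'), ∀ x ∈ S j, AlgCat.hom (F.map f) x ∈ S j')
    (hne : ∀ j, Nonempty (S j)) : subFunctor F S hS hne ⟶ F where
  app j := (S j).subtype.toHom
  naturality _ _ _ := rfl

end Subfunctor

/-! ### Products -/

instance piStructure [L.IsAlgebraic] {X : Type*} {A : X → Type*} [∀ x, L.Structure (A x)] :
    L.Structure (∀ x, A x) where
  funMap f b x := FirstOrder.Language.Structure.funMap f fun k => b k x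
  RelMap r := isEmptyElim r

/-- The projections of a product. -/
def piEval [L.IsAlgebraic] {X : Type*} {A : X → Type*} [∀ x, L.Structure (A x)] (x : X) :
    L.Hom (∀ x, A x) (A x) where
  toFun b := b x
  map_fun' _ _ := rfl
  map_rel' r := isEmptyElim r

/-! ### Condensates -/

/-- The `(∨, 0)`-homomorphism underlying a morphism of `SemilatSupCat`. -/
abbrev slHom {S T : SemilatSupCat.{u}} (f : S ⟶ T) : SupBotHom S T := f

section Tree

variable {I : Type u} [PartialOrder I] {J : Type u} [SmallCategory J]

/-- The morphism of a product of a poset with a category given by its components. -/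
abbrev treeHom {i k : I} (h : i ≤ k) {j l : J} (g : j ⟶ l) : (i, j) ⟶ (k, l) := (homOfLE h, g)

/-- A family of ideal-induced maps from a diagram `N` indexed by `J` to a diagram `D` indexed by
`I × J`, indexed by the points `(i, s)` where `i : I` and `s : I → K` is a colouring. Every
element of `N` is constant along a branch up to finitely many colours. -/
structure BranchFamily (K : Type u) (N : J ⥤ SemilatSupCat.{u}) (D : I × J ⥤ SemilatSupCat.{u})
    where
  map : ∀ (_ : I → K) (i : I) (j : J), SupBotHom (N.obj j) (D.obj (i, j))
  idealInduced : ∀ s i j, IdealInduced (map s i j)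
  naturality : ∀ s i ⦃j j'⦄ (g : j ⟶ j') (β : N.obj j),
    map s i j' (slHom (N.map g) β) = slHom (D.map (treeHom (le_refl i) g)) (map s i j β)
  exists_support : ∀ j (β : N.obj j), ∃ Φ : Finset K, ∀ ⦃i k : I⦄ (h : k ≤ i) (s t : I → K),
    (∀ l ≤ k, s l = t l) → (∀ l, k < l → l ≤ i → s l ∉ Φ) →
      map s i j β = slHom (D.map (treeHom h (𝟙 j))) (map t k j β)

/-- Transport of a family along an isomorphism. -/
def BranchFamily.ofIso {K : Type u} {N N' : J ⥤ SemilatSupCat.{u}}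
    {D : I × J ⥤ SemilatSupCat.{u}} (q : BranchFamily K N D) (e : N' ≅ N) :
    BranchFamily K N' D where
  map s i j := (q.map s i j).comp (slHom (e.hom.app j))
  idealInduced s i j := (q.idealInduced s i j).comp <| idealInduced_of_bijective _ <| by
    refine Function.bijective_iff_has_inverse.2 ⟨slHom (e.inv.app j), fun x => ?_, fun x => ?_⟩
    · exact DFunLike.congr_fun (F := SupBotHom _ _) (e.hom_inv_id_app j) x
    · exact DFunLike.congr_fun (F := SupBotHom _ _) (e.inv_hom_id_app j) x
  naturality s i j j' g β := by
    refine Eq.trans ?_ (q.naturality s i g _)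
    exact congrArg (q.map s i j')
      (DFunLike.congr_fun (F := SupBotHom _ _) (e.hom.naturality g) β)
  exists_support j β := q.exists_support j _

variable (F : I × J ⥤ AlgCat.{u} L) (K : Type u)

/-- Transition maps of an `I × J`-indexed diagram of algebras. -/
abbrev treeMap {i k : I} (h : i ≤ k) {j l : J} (g : j ⟶ l) :
    L.Hom (F.obj (i, j)) (F.obj (k, l)) := AlgCat.hom (F.map (treeHom h g))

theorem treeMap_treeMap {i k m : I} (h : i ≤ k) (h' : k ≤ m) {j l n : J} (g : j ⟶ l) (g' : l ⟶ n)
    (a : F.obj (i, j)) :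
    treeMap F h' g' (treeMap F h g a) = treeMap F (h.trans h') (g ≫ g') a :=
  (DFunLike.congr_fun (F := L.Hom _ _) (F.map_comp (treeHom h g) (treeHom h' g')) a).symm

theorem treeMap_refl (i : I) (j : J) (a : F.obj (i, j)) :
    treeMap F (le_refl i) (𝟙 j) a = a :=
  DFunLike.congr_fun (F := L.Hom _ _) (F.map_id (i, j)) a

variable [L.IsAlgebraic]

/-- The product, over all points `(i, s)`, of the diagrams `F (i, -)`. -/
def pointProduct : J ⥤ AlgCat.{u} L where
  obj j := { carrier := ∀ x : I × (I → K), F.obj (x.1, j) }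
  map g :=
    { toFun := fun b x => treeMap F (le_refl x.1) g (b x)
      map_fun' := fun f _ => funext fun _ => FirstOrder.Language.Hom.map_fun _ f _
      map_rel' := fun r => isEmptyElim r }
  map_id _ := FirstOrder.Language.Hom.ext fun _ => funext fun _ => treeMap_refl F _ _ _
  map_comp g g' := FirstOrder.Language.Hom.ext fun _ => funext fun _ =>
    (treeMap_treeMap F _ _ g g' _).symm

variable {F K}

open Classical in
/-- The element of the product which is the image of `a` above the points passing through `i`
with colour `c`, and the image of `a₀` elsewhere. -/
noncomputable def spread {i₀ : I} (h₀ : ∀ i, i₀ ≤ i) {j : J} (i : I) (c : K) (a : F.obj (i, j))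
    (a₀ : F.obj (i₀, j)) : (pointProduct F K).obj j :=
  fun x => if h : i ≤ x.1 ∧ x.2 i = c then treeMap F h.1 (𝟙 j) a else
    treeMap F (h₀ x.1) (𝟙 j) a₀

theorem map_spread {i₀ : I} (h₀ : ∀ i, i₀ ≤ i) {j l : J} (g : j ⟶ l) (i : I) (c : K)
    (a : F.obj (i, j)) (a₀ : F.obj (i₀, j)) :
    AlgCat.hom ((pointProduct F K).map g) (spread h₀ i c a a₀) =
      spread h₀ i c (treeMap F le_rfl g a) (treeMap F le_rfl g a₀) := by
  funext x
  change treeMap F (le_refl x.1) g (spread h₀ i c a a₀ x) = _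
  unfold spread
  split_ifs with h
  · rw [treeMap_treeMap, treeMap_treeMap]
    simp only [Category.comp_id, Category.id_comp]
  · rw [treeMap_treeMap, treeMap_treeMap]
    simp only [Category.comp_id, Category.id_comp]

/-- An element of the product is supported by a set of colours `Φ` if it is transported along each
branch segment avoiding the colours in `Φ`. -/
def IsSupported {j : J} (b : (pointProduct F K).obj j) (Φ : Finset K) : Prop :=
  ∀ ⦃i k : I⦄ (h : k ≤ i) (s t : I → K), (∀ l ≤ k, s l = t l) →
    (∀ l, k < l → l ≤ i → s l ∉ Φ) → b (i, s) = treeMap F h (𝟙 j) (b (k, t))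

theorem IsSupported.mono {j : J} {b : (pointProduct F K).obj j} {Φ Ψ : Finset K}
    (hb : IsSupported b Φ) (h : Φ ⊆ Ψ) : IsSupported b Ψ :=
  fun _ _ hki s t hst hs => hb hki s t hst fun l hl hl' hΦ => hs l hl hl' (h hΦ)

/-- The value can depart from transport only on entering node `i` with colour `c`. As `↓m` is a
chain, `i` lies either below `k`, where `s` and `t` agree, or on the segment above `k`, where `c` is
forbidden. -/
theorem isSupported_spread (hchain : ∀ i : I, IsChain (· ≤ ·) (Set.Iic i)) {i₀ : I}
    (h₀ : ∀ i, i₀ ≤ i) {j : J} (i : I) (c : K) (a : F.obj (i, j)) (a₀ : F.obj (i₀, j)) :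
    IsSupported (spread h₀ i c a a₀) {c} := by
  intro m k hkm s t hst hs
  have key : (i ≤ m ∧ s i = c) ↔ (i ≤ k ∧ t i = c) := by
    constructor
    · rintro ⟨him, hc⟩
      have hik : i ≤ k := by
        by_contra hik
        have hki : k ≤ i := ((hchain m).total hkm him).resolve_right hik
        exact hs i (lt_of_le_not_ge hki hik) him (Finset.mem_singleton.2 hc)
      exact ⟨hik, (hst i hik) ▸ hc⟩
    · rintro ⟨hik, hc⟩
      exact ⟨hik.trans hkm, (hst i hik).trans hc⟩
  change spread h₀ i c a a₀ (m, s) = treeMap F hkm (𝟙 j) (spread h₀ i c a a₀ (k, t))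
  unfold spread
  by_cases h : i ≤ m ∧ s i = c
  · rw [dif_pos h, dif_pos (key.1 h), treeMap_treeMap, Category.comp_id]
  · rw [dif_neg h, dif_neg (mt key.2 h), treeMap_treeMap, Category.comp_id]

theorem exists_isSupported_funMap {j : J} {n : ℕ} (f : L.Functions n)
    (b : Fin n → (pointProduct F K).obj j) (hb : ∀ m, ∃ Φ, IsSupported (b m) Φ) :
    ∃ Φ, IsSupported (FirstOrder.Language.Structure.funMap f b : (pointProduct F K).obj j) Φ := by
  classical
  choose Φ hΦ using hb
  refine ⟨Finset.univ.biUnion Φ, fun i k hki s t hst hs => ?_⟩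
  have h : ∀ m, b m (i, s) = treeMap F hki (𝟙 j) (b m (k, t)) := fun m =>
    (hΦ m).mono (Finset.subset_biUnion_of_mem Φ (Finset.mem_univ m)) hki s t hst hs
  refine Eq.trans ?_ (FirstOrder.Language.Hom.map_fun (treeMap F hki (𝟙 j)) f _).symm
  exact congrArg (FirstOrder.Language.Structure.funMap f) (funext h)

variable (F K) in
/-- The subalgebra of the product generated by all elements `spread h₀ i c a a₀`. -/
noncomputable def condensateSub {i₀ : I} (h₀ : ∀ i, i₀ ≤ i) (j : J) :
    L.Substructure ((pointProduct F K).obj j) :=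
  FirstOrder.Language.Substructure.closure L
    (Set.range fun p : Σ i, K × F.obj (i, j) × F.obj (i₀, j) =>
      spread h₀ p.1 p.2.1 p.2.2.1 p.2.2.2)

theorem spread_mem_condensateSub {i₀ : I} (h₀ : ∀ i, i₀ ≤ i) {j : J} (i : I) (c : K)
    (a : F.obj (i, j)) (a₀ : F.obj (i₀, j)) :
    spread h₀ i c a a₀ ∈ condensateSub F K h₀ j :=
  FirstOrder.Language.Substructure.subset_closure ⟨⟨i, c, a, a₀⟩, rfl⟩

theorem exists_isSupported (hchain : ∀ i : I, IsChain (· ≤ ·) (Set.Iic i)) {i₀ : I}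
    (h₀ : ∀ i, i₀ ≤ i) {j : J} (b : (pointProduct F K).obj j)
    (hb : b ∈ condensateSub F K h₀ j) : ∃ Φ, IsSupported b Φ := by
  refine FirstOrder.Language.Substructure.closure_induction
    (p := fun b => ∃ Φ, IsSupported b Φ) hb ?_ ?_
  · rintro _ ⟨p, rfl⟩
    exact ⟨_, isSupported_spread hchain h₀ _ _ _ _⟩
  · exact fun {n} f b hb => exists_isSupported_funMap f b hb

theorem map_mem_condensateSub {i₀ : I} (h₀ : ∀ i, i₀ ≤ i) ⦃j j' : J⦄ (g : j ⟶ j')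
    (b : (pointProduct F K).obj j) (hb : b ∈ condensateSub F K h₀ j) :
    AlgCat.hom ((pointProduct F K).map g) b ∈ condensateSub F K h₀ j' := by
  have hle : condensateSub F K h₀ j ≤
      (condensateSub F K h₀ j').comap (AlgCat.hom ((pointProduct F K).map g)) := by
    refine FirstOrder.Language.Substructure.closure_le.2 ?_
    rintro _ ⟨p, rfl⟩
    change AlgCat.hom ((pointProduct F K).map g) _ ∈ condensateSub F K h₀ j'
    rw [map_spread]
    exact spread_mem_condensateSub h₀ _ _ _ _
  exact hle hb

/-- Although the product runs over all colourings, the generators are indexed by a node, a colour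
and two elements, hence number at most `κ`. Finite supports pass from elements to compact
congruences through their finitely many generators. -/
theorem exists_condensate {V : ObjectProperty (AlgCat.{u} L)} (hV : IsVariety V)
    {κ : Cardinal.{u}} (hκ : ℵ₀ ≤ κ) (hloc : LocallyLE V κ) (hI : IsWellFoundedTree I)
    (hIκ : #I ≤ κ) [Nonempty K] (hK : #K ≤ κ) (F : I × J ⥤ AlgCat.{u} L) (hFV : ∀ x, V (F.obj x))
    (hF : ∀ x, #(F.obj x) ≤ κ) (D : I × J ⥤ SemilatSupCat.{u}) (r : F ⋙ Conc L ⟶ D)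
    (hr : ∀ x, IdealInduced (slHom (r.app x))) :
    ∃ G : J ⥤ AlgCat.{u} L, (∀ j, V (G.obj j)) ∧ (∀ j, #(G.obj j) ≤ κ) ∧
      Nonempty (BranchFamily K (G ⋙ Conc L) D) := by
  classical
  obtain ⟨i₀, h₀⟩ := hI.exists_least
  have hne : ∀ j, Nonempty (condensateSub F K h₀ j) := fun j =>
    ⟨⟨_, spread_mem_condensateSub h₀ i₀ (Classical.arbitrary K) (Classical.arbitrary _)
      (Classical.arbitrary _)⟩⟩
  let P := pointProduct F K
  have hPV : ∀ j, V (P.obj j) := fun j => hV.of_jointly_injective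
    (fun x : I × (I → K) => F.obj (x.1, j)) (fun x => piEval x) (fun _ _ h => funext h)
    fun x => hFV _
  let G := subFunctor P (condensateSub F K h₀) (map_mem_condensateSub h₀) hne
  let π : ∀ (s : I → K) (i : I) (j : J), L.Hom (G.obj j) (F.obj (i, j)) := fun s i j =>
    (piEval (A := fun x : I × (I → K) => F.obj (x.1, j)) (i, s)).comp
      (condensateSub F K h₀ j).subtype.toHom
  have hπ : ∀ s i j, Function.Surjective (π s i j) := fun s i j a => by
    -- The colour `s i` makes the point `(i, s)` see `a` itself.
    refine ⟨⟨spread h₀ i (s i) a (Classical.arbitrary _), spread_mem_condensateSub h₀ _ _ _ _⟩, ?_⟩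
    change spread h₀ i (s i) a _ (i, s) = a
    unfold spread
    rw [dif_pos ⟨le_rfl, rfl⟩, treeMap_refl]
  refine ⟨G, fun j => ?_, fun j => ?_, ⟨?_⟩⟩
  · exact hV.of_jointly_injective (fun _ : Unit => P.obj j)
      (fun _ => (condensateSub F K h₀ j).subtype.toHom)
      (fun _ _ h => Subtype.ext (h ())) fun _ => hPV j
  · refine mk_substructure_closure_le hκ (hloc _ (hPV j)) _ (mk_range_le.trans ?_)
    rw [mk_sigma]
    refine (sum_le_sum _ (fun _ => κ) fun i => ?_).trans ?_
    · rw [mk_prod, mk_prod, lift_id, lift_id, lift_id, lift_id]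
      exact (mul_le_mul' hK ((mul_le_mul' (hF _) (hF _)).trans (mul_eq_self hκ).le)).trans
        (mul_eq_self hκ).le
    · rw [sum_const']
      exact (mul_le_mul' hIκ le_rfl).trans (mul_eq_self hκ).le
  · have hnat : ∀ {x y : I × J} (f : x ⟶ y) (α : ConcType L (F.obj x)),
        slHom (r.app y) (concMap (AlgCat.hom (F.map f)) α) =
          slHom (D.map f) (slHom (r.app x) α) := fun f α =>
      DFunLike.congr_fun (F := SupBotHom _ _) (r.naturality f) α
    exact
    { map := fun s i j => (slHom (r.app (i, j))).comp (concMap (π s i j))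
      idealInduced := fun s i j => (hr (i, j)).comp (idealInduced_concMap _ (hπ s i j))
      naturality := fun s i j j' g (β : ConcType L (G.obj j)) => by
        change slHom (r.app (i, j')) (concMap (π s i j') (concMap (AlgCat.hom (G.map g)) β)) =
          slHom (D.map _) (slHom (r.app (i, j)) (concMap (π s i j) β))
        rw [← hnat, ← concMap_comp, ← concMap_comp]
        rfl
      exists_support := fun j (β : ConcType L (G.obj j)) => by
        obtain ⟨Q, hQ, rfl⟩ := exists_eq_genc β
        choose Φ hΦ using fun b : G.obj j => exists_isSupported hI.isChain h₀ b.1 b.2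
        refine ⟨hQ.toFinset.biUnion fun p => Φ p.1 ∪ Φ p.2, fun i k h s t hst hs => ?_⟩
        change slHom (r.app (i, j)) (concMap (π s i j) (genc L Q hQ)) =
          slHom (D.map _) (slHom (r.app (k, j)) (concMap (π t k j) (genc L Q hQ)))
        rw [← hnat, ← concMap_comp]
        congr 1
        rw [concMap_genc, concMap_genc]
        congr 1
        refine Set.image_congr fun p hp => ?_
        have hsub : Φ p.1 ∪ Φ p.2 ⊆ hQ.toFinset.biUnion fun p => Φ p.1 ∪ Φ p.2 :=
          Finset.subset_biUnion_of_mem (fun p => Φ p.1 ∪ Φ p.2) (hQ.mem_toFinset.2 hp)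
        exact Prod.ext
          ((hΦ p.1).mono (Finset.subset_union_left.trans hsub) h s t hst hs)
          ((hΦ p.2).mono (Finset.subset_union_right.trans hsub) h s t hst hs) }

end Tree

/-! ### Choosing a branch family of subalgebras -/

/-- Well-founded construction of a function subject to constraints `Q i f` depending only on the
values of `f` at the elements below `i`. -/
theorem exists_forall_of_extend {I α : Type*} [PartialOrder I] [WellFoundedLT I] [DecidableEq I]
    [Nonempty α] (Q : I → (I → α) → Prop)
    (hQ : ∀ i f g, (∀ k ≤ i, f k = g k) → Q i f → Q i g)
    (hstep : ∀ i f, (∀ k < i, Q k f) → ∃ a, Q i (Function.update f i a)) :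
    ∃ f, ∀ i, Q i f := by
  classical
  -- The arbitrary value off the part below `i` is harmless, since `Q i` reads only values at or
  -- below `i`.
  let ext : ∀ i, (∀ k, k < i → α) → I → α := fun i p k =>
    if h : k < i then p k h else Classical.arbitrary α
  let f : I → α := (wellFounded_lt (α := I)).fix fun i p =>
    Classical.epsilon fun a => Q i (Function.update (ext i p) i a)
  have hf : ∀ i, f i = Classical.epsilon fun a =>
      Q i (Function.update (ext i fun k _ => f k) i a) := fun i => WellFounded.fix_eq _ _ _
  have hext : ∀ i k, k < i → ext i (fun k _ => f k) k = f k := fun i k hk => dif_pos hk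
  refine ⟨f, fun i => ?_⟩
  induction i using (wellFounded_lt (α := I)).induction with | _ i ih =>
  have h := Classical.epsilon_spec (hstep i (ext i fun k _ => f k) fun k hk =>
    hQ k f _ (fun l hl => (hext i l (hl.trans_lt hk)).symm) (ih k hk))
  rw [← hf] at h
  refine hQ i _ _ (fun k hk => ?_) h
  rcases hk.eq_or_lt with rfl | hk
  · exact Function.update_self _ _ _
  · rw [Function.update_of_ne hk.ne, hext i k hk]

theorem sum_lt_of_lt_cof_ord {ι : Type u} {κ : Cardinal.{u}} (hκ : ℵ₀ ≤ κ)
    (hι : #ι < κ.ord.cof) {f : ι → Cardinal.{u}} (hf : ∀ i, f i < κ) : Cardinal.sum f < κ :=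
  (sum_le_mk_mul_iSup f).trans_lt (mul_lt_of_lt hκ (hι.trans_le (Ordinal.cof_ord_le κ))
    (Cardinal.iSup_lt_of_lt_cof_ord hι hf))

theorem IsWellFoundedTree.wellFoundedLT {I : Type u} [PartialOrder I]
    (hI : IsWellFoundedTree I) : WellFoundedLT I := by
  refine ⟨⟨fun i => ?_⟩⟩
  refine (hI.isWF i).induction (P := Acc (· < ·)) (le_refl i) fun k hk ih => ?_
  exact ⟨k, fun l hl => ih l (hl.le.trans hk) hl⟩

section Tree

variable {I : Type u} [PartialOrder I] {J : Type u} [SmallCategory J]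

theorem slHom_map_treeHom_refl (D : I × J ⥤ SemilatSupCat.{u}) (i : I) (j : J)
    (x : D.obj (i, j)) : slHom (D.map (treeHom (le_refl i) (𝟙 j))) x = x :=
  DFunLike.congr_fun (F := SupBotHom _ _) (D.map_id (i, j)) x

/-- The support condition with `k = i`: the segment is empty, so the map at `i` sees only the
colours at or below `i`. This locality makes the recursion below legitimate. -/
theorem BranchFamily.map_congr {K : Type u} {N : J ⥤ SemilatSupCat.{u}}
    {D : I × J ⥤ SemilatSupCat.{u}} (q : BranchFamily K N D) {i : I} {s t : I → K}
    (h : ∀ l ≤ i, s l = t l) (j : J) : q.map s i j = q.map t i j := by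
  refine SupBotHom.ext fun β => ?_
  obtain ⟨Φ, hΦ⟩ := q.exists_support j β
  rw [hΦ le_rfl s t h fun l hl hl' => (hl.not_ge hl').elim, slHom_map_treeHom_refl]

/-- Naturality along `k ≤ i` is bought by colours: if no colour on the segment lies in the support
of a principal congruence, its value at `i` is transported from `k`. -/
theorem exists_branch_subalgebras (hI : IsWellFoundedTree I) {lam κ : Cardinal.{u}}
    (hlam : ℵ₀ ≤ lam) (hlamκ : lam < κ) (hJ : #(Arrow J) < κ)
    (hIcof : ∀ i : I, #(Set.Iic i) < κ.ord.cof) {K : Type u} (hK : #K = κ)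
    (D : I × J ⥤ SemilatSupCat.{u})
    (hDsum : ∀ i, ¬ IsMax i → Cardinal.sum (fun j : J => #(D.obj (i, j))) < κ)
    (C : J ⥤ AlgCat.{u} L) (hC : ∀ j, ∀ S : L.Substructure (C.obj j), S.FG → #S ≤ lam)
    (q : BranchFamily K (C ⋙ Conc L) D) :
    ∃ (s : I → K) (S : I → ∀ j, L.Substructure (C.obj j)),
      (∀ i j, Nonempty (S i j)) ∧
      (∀ i ⦃j j'⦄ (g : j ⟶ j'), ∀ x ∈ S i j, AlgCat.hom (C.map g) x ∈ S i j') ∧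
      (∀ ⦃k i⦄, k ≤ i → ∀ j, S k j ≤ S i j) ∧
      (∀ i j, IdealInduced ((q.map s i j).comp (concMap (S i j).subtype.toHom))) ∧
      ∀ ⦃k i⦄ (h : k ≤ i) (j), ∀ x ∈ S k j, ∀ y ∈ S k j,
        q.map s i j (principal L x y) =
          slHom (D.map (treeHom h (𝟙 j))) (q.map s k j (principal L x y)) := by
  classical
  have hκ : ℵ₀ ≤ κ := hlam.trans hlamκ.le
  have := hI.wellFoundedLT
  have hKne : Nonempty K := mk_ne_zero_iff.1 (hK ▸ (aleph0_pos.trans_le hκ).ne')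
  choose Φ hΦ using q.exists_support
  -- The size bound is imposed only at non-maximal nodes; every `k < i` is one, so all earlier
  -- stages are small. The last clause is the choice of a fresh colour.
  let Q : I → (I → K × ∀ j, L.Substructure (C.obj j)) → Prop := fun i f =>
    (∀ j, Nonempty ((f i).2 j)) ∧
    (∀ ⦃j j'⦄ (g : j ⟶ j'), ∀ x ∈ (f i).2 j, AlgCat.hom (C.map g) x ∈ (f i).2 j') ∧
    (∀ k < i, ∀ j, (f k).2 j ≤ (f i).2 j) ∧
    (∀ j, IdealInduced ((q.map (fun k => (f k).1) i j).comp
      (concMap ((f i).2 j).subtype.toHom))) ∧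
    (¬ IsMax i → Cardinal.sum (fun j => #((f i).2 j)) < κ) ∧
    ∀ k < i, ∀ j, ∀ x ∈ (f k).2 j, ∀ y ∈ (f k).2 j, (f i).1 ∉ Φ j (principal L x y)
  obtain ⟨f, hf⟩ : ∃ f, ∀ i, Q i f := by
    refine exists_forall_of_extend Q (fun i f g hfg h => ?_) fun i f ih => ?_
    · obtain ⟨h₁, h₂, h₃, h₄, h₅, h₆⟩ := h
      have hi := hfg i le_rfl
      refine ⟨hi ▸ h₁, hi ▸ h₂, fun k hk => hfg k hk.le ▸ hi ▸ h₃ k hk, fun j => ?_, hi ▸ h₅,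
        fun k hk => hfg k hk.le ▸ hi ▸ h₆ k hk⟩
      rw [← hi, ← q.map_congr (s := fun k => (f k).1) fun l hl => by rw [hfg l hl]]
      exact h₄ j
    · have hκk : ∀ k : Set.Iio i, Cardinal.sum (fun j => #((f k).2 j)) < κ := fun k =>
        (ih k k.2).2.2.2.2.1 fun h => h.not_lt k.2
      have hIio : #(Set.Iio i) < κ.ord.cof :=
        (mk_le_mk_of_subset Set.Iio_subset_Iic_self).trans_lt (hIcof i)
      obtain ⟨c, hc⟩ : ∃ c, ∀ k < i, ∀ j, ∀ x ∈ (f k).2 j, ∀ y ∈ (f k).2 j,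
          c ∉ Φ j (principal L x y) := by
        -- The pairs whose supports must be avoided. Their number is below `κ` by the cofinality
        -- bound, and finite supports keep the union below `κ`, which is uncountable as `ℵ₀ ≤ lam <
        -- κ`.
        let ι := Σ k : Set.Iio i, Σ j, (f k).2 j × (f k).2 j
        have hι : #ι < κ := by
          rw [mk_sigma]
          refine sum_lt_of_lt_cof_ord hκ hIio fun k => ?_
          refine (mk_le_of_injective (β := (Σ j, (f k).2 j) × Σ j, (f k).2 j)
            (f := fun t => (⟨t.1, t.2.1⟩, ⟨t.1, t.2.2⟩)) ?_).trans_lt ?_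
          · rintro ⟨j, x, y⟩ ⟨j', x', y'⟩ h
            obtain ⟨h, h'⟩ := Prod.mk.inj h
            obtain ⟨rfl, h⟩ := Sigma.mk.inj h
            obtain ⟨-, h'⟩ := Sigma.mk.inj h'
            obtain rfl := eq_of_heq h
            obtain rfl := eq_of_heq h'
            rfl
          · rw [mk_prod, lift_id, mk_sigma]
            exact mul_lt_of_lt hκ (hκk k) (hκk k)
        let U : Set K := ⋃ t : ι, (Φ t.2.1 (principal L (t.2.2.1 : C.obj t.2.1) t.2.2.2) : Set K)
        have hU : #U < #K := by
          rw [hK]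
          refine (mk_iUnion_le_sum_mk.trans (sum_le_sum _ (fun _ => ℵ₀) fun t => ?_)).trans_lt ?_
          · exact (Finset.finite_toSet _).lt_aleph0.le
          · rw [sum_const']
            exact mul_lt_of_lt hκ hι (hlam.trans_lt hlamκ)
        obtain ⟨c, hc⟩ : ∃ c, c ∉ U := by
          by_contra! h
          exact hU.ne (by rw [Set.eq_univ_of_forall h, mk_univ])
        exact ⟨c, fun k hk j x hx y hy h =>
          hc (Set.mem_iUnion.2 ⟨⟨⟨k, hk⟩, j, ⟨x, hx⟩, ⟨y, hy⟩⟩, h⟩)⟩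
      let s : I → K := Function.update (fun k => (f k).1) i c
      obtain ⟨S, hS₁, hS₂, hS₃, hS₄, hS₅⟩ : ∃ S : ∀ j, L.Substructure (C.obj j),
          (∀ j, Nonempty (S j)) ∧
          (∀ ⦃j j'⦄ (g : j ⟶ j'), ∀ x ∈ S j, AlgCat.hom (C.map g) x ∈ S j') ∧
          (∀ k < i, ∀ j, (f k).2 j ≤ S j) ∧
          (∀ j, IdealInduced ((q.map s i j).comp (concMap (S j).subtype.toHom))) ∧
          (¬ IsMax i → Cardinal.sum (fun j => #(S j)) < κ) := by
        -- At a maximal node nothing follows, so the whole algebra serves and no bound on the sum of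
        -- the `D (i, j)` is needed.
        by_cases hmax : IsMax i
        · refine ⟨fun j => ⊤, fun j => ⟨⟨Classical.arbitrary _, trivial⟩⟩,
            fun _ _ _ _ _ => trivial, fun _ _ _ => le_top, fun j => ?_, fun h => (h hmax).elim⟩
          exact (q.idealInduced s i j).comp (idealInduced_concMap _ fun x => ⟨⟨x, trivial⟩, rfl⟩)
        · let X₀ : ∀ j, Set (C.obj j) := fun j => ⋃ k : Set.Iio i, ((f k).2 j : Set (C.obj j))
          have hX₀ : Cardinal.sum (fun j => #(X₀ j)) < κ := by
            rw [← mk_sigma]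
            refine (mk_le_of_surjective (α := Σ k : Set.Iio i, Σ j, (f k).2 j)
              (f := fun t => ⟨t.2.1, t.2.2.1, Set.mem_iUnion.2 ⟨t.1, t.2.2.2⟩⟩) ?_).trans_lt ?_
            · rintro ⟨j, x, hx⟩
              obtain ⟨k, hk⟩ := Set.mem_iUnion.1 hx
              exact ⟨⟨k, j, x, hk⟩, rfl⟩
            · rw [mk_sigma]
              refine sum_lt_of_lt_cof_ord hκ hIio fun k => ?_
              rw [mk_sigma]
              exact hκk k
          -- Every cost of the Löwenheim–Skolem step is strictly below `κ`, so one `μ < κ` dominates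
          -- them all.
          let μ := max (max lam #(Arrow J)) (max (Cardinal.sum fun j => #(D.obj (i, j)))
            (Cardinal.sum fun j => #(X₀ j)))
          have hμ : μ < κ := max_lt (max_lt hlamκ hJ) (max_lt (hDsum i hmax) hX₀)
          have hlamμ : lam ≤ μ := (le_max_left _ _).trans (le_max_left _ _)
          obtain ⟨S, h₁, h₂, h₃, h₄, h₅⟩ := exists_small_substructures C (hlam.trans hlamμ)
            ((le_max_right _ _).trans (le_max_left _ _)) (fun j S hS => (hC j S hS).trans hlamμ)
            (fun j => D.obj (i, j)) (fun j => q.map s i j) (q.idealInduced s i)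
            ((le_max_left _ _).trans (le_max_right _ _)) X₀
            ((le_max_right _ _).trans (le_max_right _ _))
          exact ⟨S, h₃, h₂, fun k hk j x hx => h₁ j (Set.mem_iUnion.2 ⟨⟨k, hk⟩, hx⟩), h₅,
            fun _ => h₄.trans_lt hμ⟩
      refine ⟨(c, S), ?_⟩
      have hs : (fun k => (Function.update f i (c, S) k).1) = s := by
        funext k
        by_cases hk : k = i
        · subst hk
          simp [s]
        · simp [s, hk]
      have hself : Function.update f i (c, S) i = (c, S) := Function.update_self _ _ _
      have hlt : ∀ k < i, Function.update f i (c, S) k = f k := fun k hk =>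
        Function.update_of_ne hk.ne _ _
      simp only [Q]
      rw [hs, hself]
      refine ⟨hS₁, hS₂, fun k hk => ?_, hS₄, hS₅, fun k hk => ?_⟩
      · rw [hlt k hk]
        exact hS₃ k hk
      · rw [hlt k hk]
        exact hc k hk
  refine ⟨fun i => (f i).1, fun i => (f i).2, fun i => (hf i).1, fun i => (hf i).2.1,
    fun k i hki j => ?_, fun i => (hf i).2.2.2.1, fun k i hki j x hx y hy => ?_⟩
  · rcases hki.eq_or_lt with rfl | hki
    · exact le_rfl
    · exact (hf i).2.2.1 k hki j
  -- Every node `l` above `k` had its colour chosen outside the support of `principal L x y`,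
  -- because `x` and `y` lie in the stage `k < l`.
  · exact hΦ j _ hki _ _ (fun _ _ => rfl) fun l hl _ => (hf l).2.2.2.2.2 k hl j x hx y hy

end Tree

/-! ### Quotients of diagrams -/

section Quotient

variable {X : Type u} [SmallCategory X] [L.IsAlgebraic]

/-- Naturality of `r` sends zero sets into zero sets, so the transition maps descend to the
quotients; ideal-inducedness makes the induced maps to `D` isomorphisms. -/
theorem exists_quotient_diagram (F : X ⥤ AlgCat.{u} L) (D : X ⥤ SemilatSupCat.{u})
    (r : F ⋙ Conc L ⟶ D) (hr : ∀ x, IdealInduced (slHom (r.app x))) :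
    ∃ E : X ⥤ AlgCat.{u} L, (∀ x, ∃ p : L.Hom (F.obj x) (E.obj x), Function.Surjective p) ∧
      Nonempty (E ⋙ Conc L ≅ D) := by
  have hnat : ∀ {x y : X} (f : x ⟶ y) (α : ConcType L (F.obj x)),
      slHom (r.app y) (concMap (AlgCat.hom (F.map f)) α) =
        slHom (D.map f) (slHom (r.app x) α) := fun f α =>
    DFunLike.congr_fun (F := SupBotHom _ _) (r.naturality f) α
  let ρ : ∀ x, SupBotHom (ConcType L (F.obj x)) (D.obj x) := fun x => slHom (r.app x)
  have hθ : ∀ {x y : X} (f : x ⟶ y),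
      zeroSet (ρ x) ≤ comap (AlgCat.hom (F.map f)) (zeroSet (ρ y)) := fun {x y} f a b h => by
    change slHom (r.app y) (principal L _ _) = ⊥
    rw [← concMap_principal, hnat]
    exact (congrArg (slHom (D.map f)) h).trans (map_bot _)
  let E : X ⥤ AlgCat.{u} L :=
    { obj := fun x =>
        { carrier := Quotient (zeroSet (ρ x)).toSetoid
          nonempty := ⟨proj (zeroSet (ρ x)) (Classical.arbitrary _)⟩ }
      map := fun f => quotientMap (AlgCat.hom (F.map f)) _ _ (hθ f)
      map_id := fun x => FirstOrder.Language.Hom.ext fun a => by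
        obtain ⟨a, rfl⟩ := proj_surjective _ a
        rw [quotientMap_proj, F.map_id]
        rfl
      map_comp := fun f g => FirstOrder.Language.Hom.ext fun a => by
        obtain ⟨a, rfl⟩ := proj_surjective _ a
        rw [quotientMap_proj, F.map_comp]
        rfl }
  choose e he using fun x => exists_conc_quotient_iso (ρ x) (hr x)
  refine ⟨E, fun x => ⟨proj (zeroSet (ρ x)), proj_surjective _⟩, ⟨NatIso.ofComponents
    (fun x => SemilatSupCat.Iso.mk (α := (Conc L).obj (E.obj x)) (e x)) fun {x y} f => SupBotHom.ext fun β => ?_⟩⟩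
  obtain ⟨α, rfl⟩ := (idealInduced_concMap _ (proj_surjective (zeroSet (ρ x)))).surjective β
  change e y (concMap (quotientMap (AlgCat.hom (F.map f)) _ _ (hθ f)) (concMap (proj _) α)) =
    slHom (D.map f) (e x (concMap (proj _) α))
  rw [he, ← concMap_comp]
  refine Eq.trans ?_ (hnat f α)
  refine Eq.trans ?_ (he y _)
  rw [← concMap_comp]
  rfl

end Quotient

/-! ### Size of `Con_c` and packaging of liftings -/

theorem mk_concType_le {A : Type u} [L.Structure A] {κ : Cardinal.{u}} (hκ : ℵ₀ ≤ κ)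
    (hA : #A ≤ κ) : #(ConcType L A) ≤ κ := by
  refine (mk_le_of_surjective (f := fun P : Finset (A × A) =>
    genc L (P : Set (A × A)) P.finite_toSet) fun α => ?_).trans
      ((mk_finset_le_max _).trans (max_le hκ ?_))
  · obtain ⟨P, hP, rfl⟩ := exists_eq_genc α
    lift P to Finset (A × A) using hP
    exact ⟨P, rfl⟩
  · rw [mk_prod, lift_id]
    exact (mul_le_mul' hA hA).trans (mul_eq_self hκ).le

theorem hasLifting_of_iso {V : ObjectProperty (AlgCat.{u} L)} {J : Type u} [SmallCategory J]
    {D : J ⥤ SemilatSupCat.{u}} (E : J ⥤ AlgCat.{u} L) (hE : ∀ j, V (E.obj j))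
    (e : E ⋙ Conc L ≅ D) : HasLifting V D :=
  ⟨V.lift E hE, ⟨e⟩⟩

end CongLift

/-! ### Assembly of the lifting in the second variety -/

open CongLift CongLift.AlgCongruence in
theorem corollaryC
    (L₁ : FirstOrder.Language.{v₁, w₁}) [L₁.IsAlgebraic]
    (L₂ : FirstOrder.Language.{v₂, w₂}) [L₂.IsAlgebraic]
    (V₁ : ObjectProperty (CongLift.AlgCat.{u} L₁)) (hV₁ : CongLift.IsVariety V₁)
    (V₂ : ObjectProperty (CongLift.AlgCat.{u} L₂)) (hV₂ : CongLift.IsVariety V₂)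
    (lam κ : Cardinal.{u}) (hlam : ℵ₀ ≤ lam) (hlamκ : lam < κ)
    (I : Type u) [PartialOrder I] (hI : CongLift.IsWellFoundedTree I)
    (J : Type u) [SmallCategory J]
    (hloc₁ : CongLift.LocallyLE V₁ κ) (hloc₂ : CongLift.LocallyLE V₂ lam)
    (hJ : #(Arrow J) < κ)
    (hIcard : #I ≤ κ)
    (hIcof : ∀ i : I, #(Set.Iic i) < κ.ord.cof)
    (hlift : ∀ D : J ⥤ SemilatSupCat.{u}, (∀ j, #(D.obj j) ≤ κ) →
      CongLift.HasLifting V₁ D → CongLift.HasLifting V₂ D)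
    (D : I × J ⥤ SemilatSupCat.{u})
    (hD : ∀ i j, #(D.obj (i, j)) < κ)
    (hDsum : ∀ i, ¬ IsMax i → Cardinal.sum (fun j : J => #(D.obj (i, j))) < κ)
    (hD₁ : CongLift.HasLifting V₁ D) :
    CongLift.HasLifting V₂ D := by
  have hκ : ℵ₀ ≤ κ := hlam.trans hlamκ.le
  obtain ⟨A', ⟨eA⟩⟩ := hD₁
  let A := A' ⋙ V₁.ι
  have hAV : ∀ x, V₁ (A.obj x) := fun x => (A'.obj x).property
  obtain ⟨K, hK⟩ : ∃ K : Type u, #K = κ := ⟨κ.out, mk_out κ⟩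
  have : Nonempty K := mk_ne_zero_iff.1 (hK ▸ (aleph0_pos.trans_le hκ).ne')
  have hJ' : #J ≤ κ := (mk_le_of_injective (f := fun j : J => Arrow.mk (𝟙 j))
    fun j j' h => congrArg (fun f : Arrow J => f.left) h).trans hJ.le
  have hIJ : #(I × J) ≤ κ := by
    rw [mk_prod, lift_id, lift_id]
    exact (mul_le_mul' hIcard hJ').trans (mul_eq_self hκ).le
  have hIJarr : #(Arrow (I × J)) ≤ κ := by
    -- Morphisms of a poset are determined by their endpoints.
    refine (mk_le_of_injective (β := (I × I) × Arrow J)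
      (f := fun f => ((f.left.1, f.right.1), Arrow.mk f.hom.2)) ?_).trans ?_
    · rintro ⟨⟨i, j⟩, ⟨k, l⟩, ⟨h, g⟩⟩ ⟨⟨i', j'⟩, ⟨k', l'⟩, ⟨h', g'⟩⟩ heq
      obtain ⟨h₁, h₂⟩ := Prod.mk.inj heq
      obtain ⟨rfl, rfl⟩ := Prod.mk.inj h₁
      cases h₂
      exact congrArg (fun h : i ⟶ k => @Arrow.mk (I × J) _ (i, j) (k, l) (h, g))
        (Subsingleton.elim _ _)
    · rw [mk_prod, mk_prod, lift_id, lift_id, lift_id]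
      exact (mul_le_mul' ((mul_le_mul' hIcard hIcard).trans (mul_eq_self hκ).le) hJ.le).trans
        (mul_eq_self hκ).le
  have hsum : ∀ {ι : Type u} (f : ι → Cardinal.{u}), #ι ≤ κ → (∀ i, f i ≤ κ) →
      Cardinal.sum f ≤ κ := fun f hι hf => by
    refine (sum_le_sum _ _ hf).trans ?_
    rw [sum_const']
    exact (mul_le_mul' hι le_rfl).trans (mul_eq_self hκ).le
  -- a lifting up to ideal-induced maps consisting of algebras of size at most `κ`
  obtain ⟨S, -, hS, hSne, hScard, hSq⟩ := exists_small_substructures A hκ hIJarr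
    (fun x => hloc₁ _ (hAV x)) D.obj (fun x => slHom (eA.hom.app x))
    (fun x => idealInduced_of_bijective _ (Function.bijective_iff_has_inverse.2
      ⟨slHom (eA.inv.app x),
        fun α => DFunLike.congr_fun (F := SupBotHom _ _) (eA.hom_inv_id_app x) α,
        fun α => DFunLike.congr_fun (F := SupBotHom _ _) (eA.inv_hom_id_app x) α⟩))
    (hsum _ hIJ fun x => (hD x.1 x.2).le) (fun _ => ∅) (hsum _ hIJ fun _ => by simp)
  obtain ⟨G, hGV, hGcard, ⟨q⟩⟩ := exists_condensate (K := K) hV₁ hκ hloc₁ hI hIcard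
    hK.le (subFunctor A S hS hSne)
    (fun x => hV₁.of_jointly_injective (fun _ : Unit => A.obj x)
      (fun _ => (S x).subtype.toHom) (fun _ _ h => Subtype.ext (h ())) fun _ => hAV x)
    (fun x => (le_sum (fun x => #(S x)) x).trans hScard) D
    (Functor.whiskerRight (subFunctorι A S hS hSne) (Conc L₁) ≫ eA.hom) hSq
  -- its lifting in the second variety
  obtain ⟨C', ⟨eC⟩⟩ := hlift (G ⋙ Conc L₁) (fun j => mk_concType_le hκ (hGcard j))
    (hasLifting_of_iso G hGV (Iso.refl _))
  let C := C' ⋙ V₂.ι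
  have hCV : ∀ j, V₂ (C.obj j) := fun j => (C'.obj j).property
  let q' : BranchFamily K (C ⋙ Conc L₂) D := q.ofIso eC
  obtain ⟨s, T, hTne, hTmap, hTmono, hTq, hT⟩ := exists_branch_subalgebras hI hlam hlamκ hJ hIcof
    hK D hDsum C (fun j => hloc₂ _ (hCV j)) q'
  -- The algebra at `(i, j)` is a subalgebra of `C j`: moving in `I` is inclusion, moving in `J` is
  -- the transition map of `C`.
  let H := subFunctor (CategoryTheory.Prod.snd I J ⋙ C) (fun x => T x.1 x.2)
    (fun x y f a ha => hTmono (leOfHom f.1) y.2 (hTmap x.1 f.2 a ha)) fun x => hTne x.1 x.2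
  obtain ⟨E, hE, ⟨e⟩⟩ := exists_quotient_diagram H D
    { app := fun x => (q'.map s x.1 x.2).comp (concMap (T x.1 x.2).subtype.toHom)
      naturality := fun x y f => SupBotHom.ext fun (α : ConcType L₂ (T x.1 x.2)) => by
        have hxy : x.1 ≤ y.1 := leOfHom f.1
        -- The `I`-direction of naturality, known on principal congruences and extended to all
        -- compact ones since these are finite joins of principal ones.
        have hα : q'.map s y.1 x.2 (concMap (T x.1 x.2).subtype.toHom α) =
            slHom (D.map (treeHom hxy (𝟙 x.2)))
              (q'.map s x.1 x.2 (concMap (T x.1 x.2).subtype.toHom α)) := by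
          refine DFunLike.congr_fun (supBotHom_ext_principal
            (φ := (q'.map s y.1 x.2).comp (concMap (T x.1 x.2).subtype.toHom))
            (ψ := (slHom (D.map (treeHom hxy (𝟙 x.2)))).comp
              ((q'.map s x.1 x.2).comp (concMap (T x.1 x.2).subtype.toHom))) fun a b => ?_) α
          have hab := concMap_principal (T x.1 x.2).subtype.toHom a b
          exact (congrArg (q'.map s y.1 x.2) hab).trans ((hT hxy x.2 _ a.2 _ b.2).trans
            (congrArg (fun β => slHom (D.map _) (q'.map s x.1 x.2 β)) hab.symm))
        have hincl : concMap (T y.1 y.2).subtype.toHom (concMap (AlgCat.hom (H.map f)) α) =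
            concMap (AlgCat.hom (C.map f.2)) (concMap (T x.1 x.2).subtype.toHom α) :=
          (concMap_comp (T y.1 y.2).subtype.toHom (AlgCat.hom (H.map f)) α).symm.trans
            (concMap_comp (AlgCat.hom (C.map f.2)) (T x.1 x.2).subtype.toHom α)
        refine (congrArg (q'.map s y.1 y.2) hincl).trans ?_
        refine (q'.naturality s y.1 f.2 (concMap (T x.1 x.2).subtype.toHom α)).trans ?_
        rw [hα]
        refine (DFunLike.congr_fun (F := SupBotHom _ _)
          (D.map_comp (treeHom hxy (𝟙 x.2)) (treeHom le_rfl f.2)) _).symm.trans ?_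
        -- Each morphism of `I × J` is a step in `I` followed by a step in `J`, which joins the two
        -- naturality statements.
        have hf : treeHom hxy (𝟙 x.2) ≫ treeHom le_rfl f.2 = f :=
          Prod.ext (Subsingleton.elim _ _) (Category.id_comp _)
        rw [hf]
        rfl } fun x => hTq x.1 x.2
  refine hasLifting_of_iso E (fun x => ?_) e
  obtain ⟨p, hp⟩ := hE x
  exact hV₂.of_surjective p hp (hV₂.of_jointly_injective (fun _ : Unit => C.obj x.2)
    (fun _ => (T x.1 x.2).subtype.toHom) (fun _ _ h => Subtype.ext (h ())) fun _ => hCV _)
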